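/- Let $\Omega\subset\mathbb C^n$ be a bounded domain with smooth boundary and let $\rho$ be a defining function of class at least $C^2$ ($\Omega=\{\rho<0\}$, $d\rho\ne0$ on $\partial\Omega$). Let $\varphi$ be a smooth strictly plurisubharmonic exhaustion function of $\mathbb C^n$, and give $\mathbb C^n$ the Kähler metric $\omega=i\partial\bar\partial\varphi=i\sum g_{j\bar k}\,dz_j\wedge d\bar z_k$. Put $T^{1,0}_z(\partial\Omega)=\{L:\partial\rho(L)=0\}$, and let $\mathcal L$ be the Levi form, i.e. the restriction of $i\partial\bar\partial\rho$ to $T^{1,0}(\partial\Omega)$, with eigenvalues $\mu_1\le\dots\le\mu_{n-1}$ with respect to $\omega$. For $1\le q\le n-1$, one says that $\partial\Omega$ satisfies *weak $Z(q)$* with respect to $\omega$ if there is a real $(1,1)$-vector field $\Upsilon=i\sum b^{\bar kj}\frac{\partial}{\partial\bar z_k}\wedge\frac{\partial}{\partial z_j}$ on $\partial\Omega$, with $(b^{\bar kj})$ Hermitian and $\Upsilon$ tangential, $\sum_j b^{\bar kj}\,\partial\rho/\partial z_j=0$ for all $k$, such that at every point of $\partial\Omega$: 1. $|\theta|^2\ge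 (i\theta\wedge\bar\theta)(\Upsilon)=\sum b^{\bar kj}\theta_j\bar\theta_k\ge 0$ for all $\theta\in\Lambda^{1,0}(\partial\Omega)$; 2. $\mu_1+\dots+\mu_q-\mathcal L(\Upsilon)\ge0$, where $\mathcal L(\Upsilon)=\sum b^{\bar kj}\,\partial^2\rho/\partial z_j\partial\bar z_k$; 3. $\omega(\Upsilon)=\sum b^{\bar kj}g_{j\bar k}\ne q$. (The condition does not depend on the choice of $\rho$. The field $\Upsilon$ is required to be of some class $C^k$, $1\le k\le\infty$.) **Proposition.** There exists a bounded domain $\Omega\subset\mathbb C^4$ with $C^\infty$ boundary such that 1. $\partial\Omega$ does not satisfy weak $Z(2)$ with respect to the Euclidean metric $i\partial\bar\partial|z|^2$; 2. for every real $t\ge6$, the function $\varphi_t(z)=t|z_1|^2+|z_2|^2+|z_3|^2+|z_4|^2$ is a smooth strictly plurisubharmonic exhaustion function of $\mathbb C^4$, and $\partial\Omega$ satisfies weak $Z(2)$ with respect to the metric $\omega_t=i\partial\bar\partial\varphi_t$. Both assertions hold for every choice of the class $C^k$, $1\le k\le\infty$, of $\Upsilon$. -/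

import Mathlib

open scoped ContDiff ComplexOrder

noncomputable section

/-! ## Wirtinger derivatives and complex Hessians on `ℂⁿ = Fin n → ℂ` -/

/-- `∂f/∂z_j = (∂f/∂x_j - i ∂f/∂y_j) / 2`. -/
def wirtinger {n : ℕ} (f : (Fin n → ℂ) → ℂ) (j : Fin n) (z : Fin n → ℂ) : ℂ :=
  (1 / 2 : ℂ) * (fderiv ℝ f z (Pi.single j 1) - Complex.I * fderiv ℝ f z (Pi.single j Complex.I))

/-- `∂f/∂z̄_j = (∂f/∂x_j + i ∂f/∂y_j) / 2`. -/
def wirtingerBar {n : ℕ} (f : (Fin n → ℂ) → ℂ) (j : Fin n) (z : Fin n → ℂ) : ℂ :=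
  (1 / 2 : ℂ) * (fderiv ℝ f z (Pi.single j 1) + Complex.I * fderiv ℝ f z (Pi.single j Complex.I))

/-- The coefficients `∂ρ/∂z_j` of the `(1,0)`-form `∂ρ`, for a real-valued `ρ`. -/
def delForm {n : ℕ} (ρ : (Fin n → ℂ) → ℝ) (z : Fin n → ℂ) : Fin n → ℂ :=
  fun j => wirtinger (fun w => (ρ w : ℂ)) j z

/-- The matrix with entries `∂²ρ/∂z_j∂z̄_k` (row `j`, column `k`), for a real-valued `ρ`; these
are the coefficients of `i∂∂̄ρ = i ∑ (∂²ρ/∂z_j∂z̄_k) dz_j ∧ dz̄_k`. -/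
def complexHessian {n : ℕ} (ρ : (Fin n → ℂ) → ℝ) (z : Fin n → ℂ) : Matrix (Fin n) (Fin n) ℂ :=
  Matrix.of fun j k => wirtinger (wirtingerBar (fun w => (ρ w : ℂ)) k) j z

/-- The sesquilinear form `∑ a_{jk̄} L_j conj(L'_k)` on `(1,0)`-vectors, i.e. the value on
`i L̄' ∧ L` of the `(1,1)`-form `i ∑ a_{jk̄} dz_j ∧ dz̄_k`. -/
def sesqForm {n : ℕ} (A : Matrix (Fin n) (Fin n) ℂ) (L L' : Fin n → ℂ) : ℂ :=
  ∑ j, ∑ k, A j k * L j * star (L' k)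

/-! ## Domains and Kähler potentials -/

/-- `ρ` is a `C^m` defining function for `Ω`: `Ω = {ρ < 0}` and `dρ ≠ 0` on `∂Ω`. -/
def IsDefiningFunction {n : ℕ} (m : ℕ∞) (Ω : Set (Fin n → ℂ)) (ρ : (Fin n → ℂ) → ℝ) : Prop :=
  ContDiff ℝ m ρ ∧ Ω = {z | ρ z < 0} ∧ ∀ z ∈ frontier Ω, fderiv ℝ ρ z ≠ 0

/-- A bounded domain (open, connected, nonempty) of `ℂⁿ` with `C^∞` boundary. -/
def IsSmoothBoundedDomain {n : ℕ} (Ω : Set (Fin n → ℂ)) : Prop :=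
  IsOpen Ω ∧ IsConnected Ω ∧ Bornology.IsBounded Ω ∧ ∃ ρ, IsDefiningFunction ⊤ Ω ρ

/-- A smooth strictly plurisubharmonic exhaustion function for `ℂⁿ`. -/
def IsStrictlyPshExhaustion {n : ℕ} (φ : (Fin n → ℂ) → ℝ) : Prop :=
  ContDiff ℝ ∞ φ ∧ (∀ z, (complexHessian φ z).PosDef) ∧ ∀ c : ℝ, IsCompact {z | φ z ≤ c}

/-! ## Eigenvalues of the Levi form -/

/-- `μ` lists in increasing order the eigenvalues of the Hermitian form with matrix `H`, restricted
to the space `{L | ∑ d_j L_j = 0}` of dimension `n - 1` (`d ≠ 0`), with respect to the Hermitian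
metric with matrix `G`: there is a `G`-orthonormal basis `u` of that space that diagonalizes the
form, with diagonal entries `μ`. -/
def IsEigenvalueList {n : ℕ} (G H : Matrix (Fin n) (Fin n) ℂ) (d : Fin n → ℂ)
    (μ : Fin (n - 1) → ℝ) : Prop :=
  Monotone μ ∧ ∃ u : Fin (n - 1) → (Fin n → ℂ),
    (∀ i, ∑ j, d j * u i j = 0) ∧
    (∀ i i', sesqForm G (u i) (u i') = if i = i' then 1 else 0) ∧
    (∀ i i', sesqForm H (u i) (u i') = if i = i' then (μ i : ℂ) else 0)

open Matrix MatrixOrder Matrix.Norms.L2Operator in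
/-- The list of eigenvalues exists. -/
theorem exists_isEigenvalueList {n : ℕ} {G H : Matrix (Fin n) (Fin n) ℂ} (hG : G.PosDef)
    (hH : H.IsHermitian) {d : Fin n → ℂ} (hd : d ≠ 0) : ∃ μ, IsEigenvalueList G H d μ := by
  classical
  let f : (Fin n → ℂ) →ₗ[ℂ] ℂ := ∑ j, d j • LinearMap.proj j
  have hf : ∀ L, f L = ∑ j, d j * L j := fun L => by simp [f]
  have hf0 : f ≠ 0 := by
    intro h
    apply hd
    funext j
    have := hf (Pi.single j 1)
    simpa [h, Pi.single_apply] using this.symm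
  have hrank : Module.finrank ℂ (LinearMap.ker f) = n - 1 := by
    have h1 := LinearMap.finrank_range_add_finrank_ker f
    have h2 : LinearMap.range f = ⊤ := LinearMap.range_eq_top.2 (LinearMap.surjective hf0)
    rw [h2] at h1
    simp at h1
    omega
  let e := Module.finBasisOfFinrankEq ℂ (LinearMap.ker f) hrank
  let E : Matrix (Fin n) (Fin (n - 1)) ℂ := Matrix.of fun k i => star ((e i : Fin n → ℂ) k)
  have hEinj : Function.Injective E.mulVec := by
    rw [← Matrix.coe_mulVecLin, ← LinearMap.ker_eq_bot, LinearMap.ker_eq_bot']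
    intro c hc
    have hc' : ∑ i, star (c i) • e i = 0 := by
      ext k
      have := congrArg star (congrFun hc k)
      simp [Matrix.mulVec, dotProduct, E] at this
      simp
      rw [← this]
      exact Finset.sum_congr rfl fun i _ => mul_comm _ _
    have := Fintype.linearIndependent_iff.1 e.linearIndependent _ hc'
    funext i
    simpa using this i
  have hA : (Eᴴ * G * E).PosDef := hG.conjTranspose_mul_mul_same hEinj
  obtain ⟨C, hCu, hC⟩ : ∃ C : Matrix (Fin (n-1)) (Fin (n-1)) ℂ, IsUnit C ∧
      Eᴴ * G * E = Cᴴ * C := by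
    obtain ⟨C, hC⟩ := CStarAlgebra.nonneg_iff_eq_star_mul_self.mp hA.posSemidef.nonneg
    refine ⟨C, ?_, hC⟩
    have := hA.isUnit
    rw [hC] at this
    exact (isUnit_of_mul_isUnit_right this)
  have hCd : IsUnit C.det := (Matrix.isUnit_iff_isUnit_det C).1 hCu
  have hCC : C * C⁻¹ = 1 := Matrix.mul_nonsing_inv C hCd
  let K := (C⁻¹)ᴴ * (Eᴴ * H * E) * C⁻¹
  have hK : K.IsHermitian := by
    simp only [K, Matrix.IsHermitian, Matrix.conjTranspose_mul, Matrix.conjTranspose_conjTranspose,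
      Matrix.mul_assoc, hH.eq]
  let U : Matrix (Fin (n-1)) (Fin (n-1)) ℂ := hK.eigenvectorUnitary
  have hU : Uᴴ * U = 1 := Unitary.coe_star_mul_self hK.eigenvectorUnitary
  have hUK : Uᴴ * K * U = Matrix.diagonal (fun i => (hK.eigenvalues i : ℂ)) := by
    have := hK.spectral_theorem
    rw [Unitary.conjStarAlgAut_apply] at this
    have h2 : Uᴴ * K * U = Uᴴ * (U * Matrix.diagonal (RCLike.ofReal ∘ hK.eigenvalues) * Uᴴ) * U := by
      conv_lhs => rw [this]
      rfl
    rw [h2]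
    simp only [Matrix.mul_assoc, hU, Matrix.mul_one]
    rw [← Matrix.mul_assoc, hU, Matrix.one_mul]
    rfl
  let F := E * C⁻¹ * U
  have hFG : Fᴴ * G * F = 1 := by
    calc Fᴴ * G * F = Uᴴ * ((C⁻¹)ᴴ * (Eᴴ * G * E) * C⁻¹) * U := by
          simp only [F, Matrix.conjTranspose_mul, Matrix.mul_assoc]
      _ = Uᴴ * ((C * C⁻¹)ᴴ * (C * C⁻¹)) * U := by
          rw [hC]; simp only [Matrix.conjTranspose_mul, Matrix.mul_assoc]
      _ = 1 := by simp [hCC, hU]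
  have hFH : Fᴴ * H * F = Matrix.diagonal (fun i => (hK.eigenvalues i : ℂ)) := by
    rw [← hUK]
    simp only [F, K, Matrix.conjTranspose_mul, Matrix.mul_assoc]
  have key : ∀ (A : Matrix (Fin n) (Fin n) ℂ) i i',
      sesqForm A (fun k => star (F k i)) (fun k => star (F k i')) = (Fᴴ * A * F) i i' := by
    intro A i i'
    simp only [sesqForm, Matrix.mul_apply, Matrix.conjTranspose_apply, star_star, Finset.sum_mul]
    rw [Finset.sum_comm]
    exact Finset.sum_congr rfl fun _ _ => Finset.sum_congr rfl fun _ _ => by ring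
  let σ := Tuple.sort hK.eigenvalues
  refine ⟨hK.eigenvalues ∘ σ, Tuple.monotone_sort _, fun i k => star (F k (σ i)), ?_, ?_, ?_⟩
  · intro i
    have : ∀ k, star (F k (σ i)) = ∑ a, star ((C⁻¹ * U) a (σ i)) * (e a : Fin n → ℂ) k := by
      intro k
      simp only [F, Matrix.mul_assoc]
      rw [Matrix.mul_apply]
      simp [E, mul_comm]
    simp only [this, Finset.mul_sum]
    rw [Finset.sum_comm]
    refine Finset.sum_eq_zero fun a _ => ?_
    have h0 : ∑ j, d j * (e a : Fin n → ℂ) j = 0 := by rw [← hf]; exact (e a).2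
    rw [← mul_zero (star ((C⁻¹ * U) a (σ i))), ← h0, Finset.mul_sum]
    exact Finset.sum_congr rfl fun _ _ => by ring
  · intro i i'
    rw [key, hFG, Matrix.one_apply]
    simp
  · intro i i'
    rw [key, hFH, Matrix.diagonal_apply]
    simp

open Matrix in
/-- The list of eigenvalues is unique. -/
theorem isEigenvalueList_unique {n : ℕ} {G H : Matrix (Fin n) (Fin n) ℂ} {d : Fin n → ℂ} (hd : d ≠ 0)
    {μ ν : Fin (n - 1) → ℝ} (hμ : IsEigenvalueList G H d μ) (hν : IsEigenvalueList G H d ν) :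
    μ = ν := by
  classical
  obtain ⟨hm, u, hut, huG, huH⟩ := hμ
  obtain ⟨hm', v, hvt, hvG, hvH⟩ := hν
  let f : (Fin n → ℂ) →ₗ[ℂ] ℂ := ∑ j, d j • LinearMap.proj j
  have hf : ∀ L, f L = ∑ j, d j * L j := fun L => by simp [f]
  have hf0 : f ≠ 0 := by
    intro h
    apply hd
    funext j
    have := hf (Pi.single j 1)
    simpa [h, Pi.single_apply] using this.symm
  have hrank : Module.finrank ℂ (LinearMap.ker f) = n - 1 := by
    have h1 := LinearMap.finrank_range_add_finrank_ker f
    have h2 : LinearMap.range f = ⊤ := LinearMap.range_eq_top.2 (LinearMap.surjective hf0)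
    rw [h2] at h1
    simp at h1
    omega
  let M : (Fin (n - 1) → Fin n → ℂ) → Matrix (Fin n) (Fin (n - 1)) ℂ :=
    fun x => Matrix.of fun k i => star (x i k)
  have key : ∀ (A : Matrix (Fin n) (Fin n) ℂ) x i i',
      sesqForm A (x i) (x i') = ((M x)ᴴ * A * M x) i i' := by
    intro A x i i'
    simp only [sesqForm, Matrix.mul_apply, Matrix.conjTranspose_apply, Finset.sum_mul, M,
      Matrix.of_apply, star_star]
    rw [Finset.sum_comm]
    exact Finset.sum_congr rfl fun _ _ => Finset.sum_congr rfl fun _ _ => by ring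
  have hUG : (M u)ᴴ * G * M u = 1 := by
    ext i i'; rw [← key, huG, Matrix.one_apply]
  have hVG : (M v)ᴴ * G * M v = 1 := by
    ext i i'; rw [← key, hvG, Matrix.one_apply]
  have hUH : (M u)ᴴ * H * M u = Matrix.diagonal (fun i => (μ i : ℂ)) := by
    ext i i'; rw [← key, huH, Matrix.diagonal_apply]
  have hVH : (M v)ᴴ * H * M v = Matrix.diagonal (fun i => (ν i : ℂ)) := by
    ext i i'; rw [← key, hvH, Matrix.diagonal_apply]
  have hli : LinearIndependent ℂ u := by
    rw [Fintype.linearIndependent_iff]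
    intro c hc
    have h0 : M u *ᵥ (fun i => star (c i)) = 0 := by
      ext k
      have := congrArg star (congrFun hc k)
      simp at this
      simp [Matrix.mulVec, dotProduct, M]
      rw [← this]
      exact Finset.sum_congr rfl fun i _ => mul_comm _ _
    have h1 : (1 : Matrix (Fin (n-1)) (Fin (n-1)) ℂ) *ᵥ (fun i => star (c i)) = 0 := by
      rw [← hUG, ← Matrix.mulVec_mulVec, h0, Matrix.mulVec_zero]
    intro i
    simpa using congrFun h1 i
  have hspan : Submodule.span ℂ (Set.range u) = LinearMap.ker f := by
    apply Submodule.eq_of_le_of_finrank_eq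
    · rw [Submodule.span_le]
      rintro _ ⟨i, rfl⟩
      exact (hf _).trans (hut i)
    · rw [hrank, finrank_span_eq_card hli]; simp
  have hc : ∀ i, ∃ c : Fin (n - 1) → ℂ, ∑ a, c a • u a = v i := fun i =>
    (Submodule.mem_span_range_iff_exists_fun ℂ).1 (by rw [hspan]; exact (hf _).trans (hvt i))
  choose c hc using hc
  let W : Matrix (Fin (n-1)) (Fin (n-1)) ℂ := Matrix.of fun a i => star (c i a)
  have hVU : M v = M u * W := by
    ext k i
    simp only [M, W, Matrix.of_apply, Matrix.mul_apply, ← hc i, Finset.sum_apply, Pi.smul_apply,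
      smul_eq_mul, star_sum, star_mul']
    exact Finset.sum_congr rfl fun _ _ => mul_comm _ _
  have hW : Wᴴ * W = 1 := by
    rw [← hVG, hVU]
    calc Wᴴ * W = Wᴴ * ((M u)ᴴ * G * M u) * W := by rw [hUG, Matrix.mul_one]
      _ = _ := by simp only [Matrix.conjTranspose_mul, Matrix.mul_assoc]
  have hW' : W * Wᴴ = 1 := mul_eq_one_comm.1 hW
  have hD : Matrix.diagonal (fun i => (ν i : ℂ)) =
      Wᴴ * (Matrix.diagonal (fun i => (μ i : ℂ)) * W) := by
    rw [← hVH, hVU, ← hUH]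
    simp only [Matrix.conjTranspose_mul, Matrix.mul_assoc]
  have hch := congrArg Matrix.charpoly hD
  rw [Matrix.charpoly_mul_comm, Matrix.mul_assoc, hW', Matrix.mul_one, Matrix.charpoly_diagonal,
    Matrix.charpoly_diagonal] at hch
  have hro := congrArg Polynomial.roots hch
  rw [Polynomial.roots_prod _ _ (Finset.prod_ne_zero_iff.2 fun i _ => Polynomial.X_sub_C_ne_zero _),
    Polynomial.roots_prod _ _ (Finset.prod_ne_zero_iff.2 fun i _ => Polynomial.X_sub_C_ne_zero _)]
    at hro
  simp only [Polynomial.roots_X_sub_C, Multiset.bind_singleton] at hro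
  have hro2 : (Finset.univ.val.map ν) = Finset.univ.val.map μ := by
    have := congrArg (Multiset.map Complex.re) hro
    simpa [Multiset.map_map, Function.comp_def] using this
  apply List.ofFn_injective
  have hp : (List.ofFn μ).Perm (List.ofFn ν) := by
    rw [← Multiset.coe_eq_coe, ← Fin.univ_val_map, ← Fin.univ_val_map, hro2]
  exact hp.eq_of_pairwise' hm.sortedLE_ofFn.pairwise hm'.sortedLE_ofFn.pairwise

/-! ## The weak `Z(q)` condition -/

/-- A real `(1,1)`-vector field `Υ = i ∑ b^{k̄j} ∂/∂z̄_k ∧ ∂/∂z_j` is represented by its Hermitian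
coefficient matrix `B`, with `B k j = b^{k̄j}`. It belongs to `T^{1,1}_z(∂Ω)` (with `∂ρ` the
conormal `d` at `z`) iff `∑_j b^{k̄j} ∂ρ/∂z_j = 0` for all `k`. -/
def IsTangentialReal {n : ℕ} (B : Matrix (Fin n) (Fin n) ℂ) (d : Fin n → ℂ) : Prop :=
  B.IsHermitian ∧ ∀ k, ∑ j, B k j * d j = 0

/-- The pairing `∑ b^{k̄j} a_{jk̄}` of the `(1,1)`-form `i ∑ a_{jk̄} dz_j ∧ dz̄_k` with
`Υ = i ∑ b^{k̄j} ∂/∂z̄_k ∧ ∂/∂z_j` (a real number when both are real). -/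
def pairing11 {n : ℕ} (A B : Matrix (Fin n) (Fin n) ℂ) : ℝ :=
  (∑ j, ∑ k, B k j * A j k).re

/-- The pairing `∑ b^{k̄j} θ_j conj(θ'_k)` of covectors. For `B = G⁻¹` it is the metric pairing
`⟨θ, θ'⟩`, and for the matrix `B` of a `(1,1)`-vector `Υ` it is `(iθ ∧ θ̄')(Υ)`. -/
def copairing {n : ℕ} (B : Matrix (Fin n) (Fin n) ℂ) (θ θ' : Fin n → ℂ) : ℂ :=
  ∑ j, ∑ k, B k j * θ j * star (θ' k)

/-- The three pointwise conditions of weak `Z(q)` at a boundary point. Here `G` is the matrix of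
the metric, `H` that of `i∂∂̄ρ`, `d` is `∂ρ` and `B` represents `Υ`. Elements of `Λ^{1,0}(∂Ω)` are,
through the orthogonal projection, the covectors `θ` orthogonal to `∂ρ`.
The list `μ` of the eigenvalues of the Levi form exists and is unique. -/
def WeakZAt {n : ℕ} (q : ℕ) (G H : Matrix (Fin n) (Fin n) ℂ) (d : Fin n → ℂ)
    (B : Matrix (Fin n) (Fin n) ℂ) : Prop :=
  IsTangentialReal B d ∧
  (∀ θ : Fin n → ℂ, copairing G⁻¹ θ d = 0 →
    0 ≤ (copairing B θ θ).re ∧ (copairing B θ θ).re ≤ (copairing G⁻¹ θ θ).re) ∧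
  (∀ μ : Fin (n - 1) → ℝ, IsEigenvalueList G H d μ →
    0 ≤ (∑ i with i.val < q, μ i) - pairing11 H B) ∧
  pairing11 G B ≠ q

/-- `∂Ω` satisfies weak `Z(q)` with respect to the Kähler metric `ω = i∂∂̄φ`, with `Υ` of class
`C^k`: sections of class `C^k` over the (closed) hypersurface `∂Ω` are taken as restrictions of
`C^k` coefficient functions on `ℂⁿ`. The Levi form is computed with a `C²` defining function; the
condition does not depend on which one. -/
def SatisfiesWeakZ {n : ℕ} (k : ℕ∞) (q : ℕ) (φ : (Fin n → ℂ) → ℝ) (Ω : Set (Fin n → ℂ)) : Prop :=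
  ∃ ρ, IsDefiningFunction 2 Ω ρ ∧
    ∃ B : (Fin n → ℂ) → Matrix (Fin n) (Fin n) ℂ,
      (∀ i j, ContDiff ℝ k fun z => B z i j) ∧
      ∀ z ∈ frontier Ω,
        WeakZAt q (complexHessian φ z) (complexHessian ρ z) (delForm ρ z) (B z)

/-- The potential `t|z₁|² + |z₂|² + |z₃|² + |z₄|²` on `ℂ⁴`. -/
def potential (t : ℝ) (z : Fin 4 → ℂ) : ℝ :=
  t * ‖z 0‖ ^ 2 + ‖z 1‖ ^ 2 + ‖z 2‖ ^ 2 + ‖z 3‖ ^ 2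

end

/-!
The domain is `Ω = {ρ < 0}` with
`ρ = |z₄|² - 9x² + 12xy + y² + 96x³ - 1`, `x = |z₁|²`, `y = |z₂|² + |z₃|²`. The Levi form vanishes at
`p = (0, 0, 0, 1)`, so that near `p` its eigenvalues are governed by the quartic part of `ρ`.

*Euclidean metric.* Let `β` be the coefficient `b^{1̄1}` of `Υ` at `p`. At the boundary points
`(ε, 0, 0, *)` the Levi form is `ε² diag(-36, 12, 12)` up to higher order, and the second condition of
weak `Z(2)`, divided by `ε²`, gives `-36β ≤ -24` in the limit, as the other diagonal coefficients of
`Υ` at `p` are nonnegative. At the points `(0, ε, 0, *)` the form is `ε² diag(12, 4, 2)`, and the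
limit gives `12β ≤ 6`. So `2/3 ≤ β ≤ 1/2`, which is absurd (`two_thirds_le_of_weakZAt`,
`le_half_of_weakZAt`).

*The metrics `ω_t`, `t ≥ 6`.* Now the Levi form has `μ₁ + μ₂ ≥ 0` everywhere, so `Υ = 0` will do. Indeed
the Hessian of `ρ` is bounded below by a diagonal form whose only negative coefficient, `-72x`, belongs
to the first coordinate, and an `ω_t`-orthonormal pair `u, v` has `t (|u₁|² + |v₁|²) ≤ 1` by Bessel's
inequality (`hessian_pair_nonneg`).

*Independence of the defining function.* The negative assertion has to exclude every `C²` defining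
function `g`. On the boundary `dg = h dρ` with `h > 0`; in the form `dg(v) dρ(ν) = dg(ν) dρ(v)` this can
be differentiated along curves in the boundary, with no derivative of `h` involved, and it follows that
the second derivatives are proportional on tangent vectors (`fderiv_fderiv_eq_mul`). This scales the
Levi form, its eigenvalues and its pairing with `Υ` by `h` (`WeakZAt.of_smul`,
`SatisfiesWeakZ.weakZAt`).
-/

open Filter Topology

/-! ### Algebra of sesquilinear forms -/

theorem sesqForm_eq_dotProduct {n : ℕ} (A : Matrix (Fin n) (Fin n) ℂ) (L L' : Fin n → ℂ) :
    sesqForm A L L' = Matrix.vecMul L A ⬝ᵥ star L' := by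
  simp only [sesqForm, dotProduct, Matrix.vecMul, Finset.sum_mul, Pi.star_apply]
  rw [Finset.sum_comm]
  exact Finset.sum_congr rfl fun _ _ => Finset.sum_congr rfl fun _ _ => by ring

theorem sesqForm_add_left {n : ℕ} (A : Matrix (Fin n) (Fin n) ℂ) (u v w : Fin n → ℂ) :
    sesqForm A (u + v) w = sesqForm A u w + sesqForm A v w := by
  simp [sesqForm_eq_dotProduct, Matrix.add_vecMul, add_dotProduct]

theorem sesqForm_add_right {n : ℕ} (A : Matrix (Fin n) (Fin n) ℂ) (u v w : Fin n → ℂ) :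
    sesqForm A w (u + v) = sesqForm A w u + sesqForm A w v := by
  simp [sesqForm_eq_dotProduct, dotProduct_add]

theorem sesqForm_smul_left {n : ℕ} (A : Matrix (Fin n) (Fin n) ℂ) (c : ℂ) (v w : Fin n → ℂ) :
    sesqForm A (c • v) w = c * sesqForm A v w := by
  simp [sesqForm_eq_dotProduct, Matrix.smul_vecMul]

theorem sesqForm_smul_right {n : ℕ} (A : Matrix (Fin n) (Fin n) ℂ) (c : ℂ) (v w : Fin n → ℂ) :
    sesqForm A v (c • w) = star c * sesqForm A v w := by
  simp [sesqForm_eq_dotProduct]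

theorem sesqForm_sum_left {n : ℕ} (A : Matrix (Fin n) (Fin n) ℂ) {ι : Type*} (s : Finset ι)
    (c : ι → ℂ) (v : ι → Fin n → ℂ) (w : Fin n → ℂ) :
    sesqForm A (∑ i ∈ s, c i • v i) w = ∑ i ∈ s, c i * sesqForm A (v i) w := by
  classical
  induction s using Finset.induction_on with
  | empty => simp [sesqForm]
  | insert a s ha ih =>
    rw [Finset.sum_insert ha, Finset.sum_insert ha, sesqForm_add_left, sesqForm_smul_left, ih]

/-- Only the restriction of a `(1,1)`-form to `T^{1,0}(∂Ω) = {L | ∑ d_j L_j = 0}` enters its pairing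
with a tangential `(1,1)`-vector. -/
theorem pairing11_eq_mul_of_tangential {n : ℕ} {A A' B : Matrix (Fin n) (Fin n) ℂ} {d : Fin n → ℂ}
    (hd : d ≠ 0) (hB : IsTangentialReal B d) (h : ℝ)
    (hA : ∀ w w' : Fin n → ℂ, ∑ j, d j * w j = 0 → ∑ j, d j * w' j = 0 →
      sesqForm A' w w' = h * sesqForm A w w') :
    pairing11 A' B = h * pairing11 A B := by
  obtain ⟨m, hm⟩ := Function.ne_iff.1 hd
  rw [Pi.zero_apply] at hm
  -- The `k`-th row of `B` is a tangential vector, and so is `e_k - (d_k / d_m) e_m`.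
  have key : ∀ C : Matrix (Fin n) (Fin n) ℂ, ∑ j, ∑ k, B k j * C j k =
      ∑ k, sesqForm C (B.row k) (Pi.single k 1 + (-(d k / d m)) • Pi.single m 1) := by
    intro C
    have h1 : ∀ k, sesqForm C (B.row k) (Pi.single k 1) = ∑ j, B k j * C j k := by
      intro k
      simp only [sesqForm, Matrix.row_apply]
      refine Finset.sum_congr rfl fun j _ => ?_
      rw [Finset.sum_eq_single k]
      · simp [mul_comm]
      · intro b _ hb; simp [hb]
      · simp
    have h2 : ∑ k, star (-(d k / d m)) • B.row k = 0 := by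
      funext j
      have h3 : ∑ k, star (d k) * B k j = 0 := by
        rw [← star_eq_zero (R := ℂ), star_sum, ← hB.2 j]
        refine Finset.sum_congr rfl fun k _ => ?_
        rw [star_mul', star_star, hB.1.apply, mul_comm]
      rw [Finset.sum_apply, Pi.zero_apply]
      calc ∑ k, (star (-(d k / d m)) • B.row k) j = -(star (d m))⁻¹ * ∑ k, star (d k) * B k j := by
            rw [Finset.mul_sum]
            refine Finset.sum_congr rfl fun k _ => ?_
            simp [div_eq_mul_inv]
            ring
        _ = 0 := by rw [h3, mul_zero]
    simp only [sesqForm_add_right, h1, sesqForm_smul_right, Finset.sum_add_distrib]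
    rw [← sesqForm_sum_left, h2, Finset.sum_comm]
    simp [sesqForm]
  have ht : ∀ k, ∑ j, d j * (Pi.single k 1 + (-(d k / d m)) • Pi.single m 1 : Fin n → ℂ) j = 0 := by
    intro k
    simp [mul_add, Finset.sum_add_distrib, Pi.single_apply]
    field_simp
    ring
  simp only [pairing11]
  rw [key A', key A, ← Complex.re_ofReal_mul, Finset.mul_sum]
  congr 1
  exact Finset.sum_congr rfl fun k _ =>
    hA _ _ (by rw [← hB.2 k]; exact Finset.sum_congr rfl fun _ _ => mul_comm _ _) (ht k)

/-- The pointwise conditions are unchanged when the conormal and the Levi form are multiplied by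
the same positive number, which is what a change of defining function does. -/
theorem WeakZAt.of_smul {n q : ℕ} {G H H' B : Matrix (Fin n) (Fin n) ℂ} {d d' : Fin n → ℂ} {h : ℝ}
    (hh : 0 < h) (hd : d ≠ 0) (hd' : ∀ j, d' j = h * d j)
    (hH : ∀ w w' : Fin n → ℂ, ∑ j, d j * w j = 0 → ∑ j, d j * w' j = 0 →
      sesqForm H' w w' = h * sesqForm H w w')
    (hW : WeakZAt q G H' d' B) : WeakZAt q G H d B := by
  obtain ⟨⟨hB1, hB2⟩, hc, hmu, hq⟩ := hW
  have hhC : (h : ℂ) ≠ 0 := by exact_mod_cast hh.ne'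
  have hsum : ∀ w : Fin n → ℂ, ∑ j, d' j * w j = h * ∑ j, d j * w j := by
    intro w
    rw [Finset.mul_sum]
    exact Finset.sum_congr rfl fun j _ => by rw [hd', mul_assoc]
  have hBd : IsTangentialReal B d := by
    refine ⟨hB1, fun k => ?_⟩
    have h1 := hB2 k
    have h2 : ∑ j, B k j * d' j = h * ∑ j, B k j * d j := by
      rw [Finset.mul_sum]
      exact Finset.sum_congr rfl fun j _ => by rw [hd']; ring
    rw [h2] at h1
    exact (mul_eq_zero.1 h1).resolve_left hhC
  refine ⟨hBd, fun θ hθ => hc θ ?_, fun μ hμ => ?_, hq⟩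
  · have h2 : copairing G⁻¹ θ d' = h * copairing G⁻¹ θ d := by
      simp only [copairing, Finset.mul_sum]
      refine Finset.sum_congr rfl fun j _ => Finset.sum_congr rfl fun k _ => ?_
      rw [hd', star_mul', Complex.star_def, Complex.conj_ofReal]
      ring
    rw [h2, hθ, mul_zero]
  · obtain ⟨hm, u, hu1, hu2, hu3⟩ := hμ
    have h1 := hmu (fun i => h * μ i) ⟨fun i j hij => mul_le_mul_of_nonneg_left (hm hij) hh.le, u,
      fun i => by rw [hsum, hu1, mul_zero], hu2, fun i i' => by
        rw [hH _ _ (hu1 i) (hu1 i'), hu3]; split_ifs <;> simp⟩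
    rw [pairing11_eq_mul_of_tangential hd hBd h hH, ← Finset.mul_sum, ← mul_sub] at h1
    exact nonneg_of_mul_nonneg_right h1 hh

/-! ### Wirtinger calculus -/

/-- `f` is real-differentiable at `z` with differential `∑ a_j dz_j + b_j dz̄_j`. -/
def HasWirtingerAt {n : ℕ} (f : (Fin n → ℂ) → ℂ) (a b : Fin n → ℂ) (z : Fin n → ℂ) : Prop :=
  ∃ f' : (Fin n → ℂ) →L[ℝ] ℂ, HasFDerivAt f f' z ∧
    ∀ v, f' v = ∑ j, (a j * v j + b j * star (v j))

namespace HasWirtingerAt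

variable {n : ℕ} {f g : (Fin n → ℂ) → ℂ} {a b a' b' : Fin n → ℂ} {z : Fin n → ℂ}

theorem apply_single (h : HasWirtingerAt f a b z) (j : Fin n) (c : ℂ) :
    fderiv ℝ f z (Pi.single j c) = a j * c + b j * star c := by
  obtain ⟨f', hf, hv⟩ := h
  rw [hf.fderiv, hv, Finset.sum_eq_single j]
  · simp
  · intro i _ hi; simp [hi]
  · simp

theorem wirtinger_eq (h : HasWirtingerAt f a b z) (j : Fin n) : wirtinger f j z = a j := by
  simp only [wirtinger, h.apply_single]
  simp
  linear_combination (-(1 / 2) * a j + (1 / 2) * b j) * Complex.I_mul_I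

theorem wirtingerBar_eq (h : HasWirtingerAt f a b z) (j : Fin n) : wirtingerBar f j z = b j := by
  simp only [wirtingerBar, h.apply_single]
  simp
  linear_combination ((1 / 2) * a j - (1 / 2) * b j) * Complex.I_mul_I

theorem const (c : ℂ) : HasWirtingerAt (fun _ : Fin n → ℂ => c) 0 0 z :=
  ⟨0, hasFDerivAt_const c z, by simp⟩

theorem coord (i : Fin n) : HasWirtingerAt (fun w : Fin n → ℂ => w i) (Pi.single i 1) 0 z :=
  ⟨ContinuousLinearMap.proj i, (ContinuousLinearMap.proj (R := ℝ) (φ := fun _ => ℂ) i).hasFDerivAt, by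
    simp [Pi.single_apply]⟩

theorem star_coord (i : Fin n) :
    HasWirtingerAt (fun w : Fin n → ℂ => star (w i)) 0 (Pi.single i 1) z :=
  ⟨(Complex.conjCLE : ℂ →L[ℝ] ℂ).comp (ContinuousLinearMap.proj i),
    ((Complex.conjCLE : ℂ →L[ℝ] ℂ).comp
      (ContinuousLinearMap.proj (R := ℝ) (φ := fun _ => ℂ) i)).hasFDerivAt, by
    simp [Pi.single_apply]⟩

theorem add (hf : HasWirtingerAt f a b z) (hg : HasWirtingerAt g a' b' z) :
    HasWirtingerAt (fun w => f w + g w) (a + a') (b + b') z := by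
  obtain ⟨f', hf, hv⟩ := hf
  obtain ⟨g', hg, hv'⟩ := hg
  refine ⟨f' + g', hf.add hg, fun v => ?_⟩
  rw [add_apply, hv, hv', ← Finset.sum_add_distrib]
  exact Finset.sum_congr rfl fun _ _ => by simp only [Pi.add_apply]; ring

theorem mul (hf : HasWirtingerAt f a b z) (hg : HasWirtingerAt g a' b' z) :
    HasWirtingerAt (fun w => f w * g w) (g z • a + f z • a') (g z • b + f z • b') z := by
  obtain ⟨f', hf, hv⟩ := hf
  obtain ⟨g', hg, hv'⟩ := hg
  refine ⟨f z • g' + g z • f', hf.mul hg, fun v => ?_⟩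
  simp only [add_apply, smul_apply, hv, hv', smul_eq_mul,
    Finset.mul_sum, ← Finset.sum_add_distrib]
  exact Finset.sum_congr rfl fun _ _ => by
    simp only [Pi.add_apply, Pi.smul_apply, smul_eq_mul]; ring

theorem const_mul (c : ℂ) (hf : HasWirtingerAt f a b z) :
    HasWirtingerAt (fun w => c * f w) (c • a) (c • b) z := by
  simpa using (const (n := n) (z := z) c).mul hf

theorem sum {ι : Type*} (s : Finset ι) {F : ι → (Fin n → ℂ) → ℂ} {α β : ι → Fin n → ℂ}
    (h : ∀ i ∈ s, HasWirtingerAt (F i) (α i) (β i) z) :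
    HasWirtingerAt (fun w => ∑ i ∈ s, F i w) (∑ i ∈ s, α i) (∑ i ∈ s, β i) z := by
  classical
  induction s using Finset.induction_on with
  | empty => simpa using const (n := n) (z := z) 0
  | insert i s hi ih =>
    simp only [Finset.sum_insert hi]
    exact (h i (Finset.mem_insert_self _ _)).add
      (ih fun j hj => h j (Finset.mem_insert_of_mem hj))

end HasWirtingerAt

/-- The metric of the potential `∑ c_j |z_j|²` has the constant matrix `diag(c)`. -/
theorem complexHessian_sum_mul_normSq {n : ℕ} (c : Fin n → ℝ) (z : Fin n → ℂ) :
    complexHessian (fun w => ∑ j, c j * ‖w j‖ ^ 2) z = Matrix.diagonal fun j => (c j : ℂ) := by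
  have h1 : (fun w : Fin n → ℂ => ((∑ j, c j * ‖w j‖ ^ 2 : ℝ) : ℂ)) =
      fun w => ∑ j, (c j : ℂ) * (w j * star (w j)) := by
    funext w
    push_cast
    simp [Complex.mul_conj']
  have h2 : ∀ k, wirtingerBar (fun w : Fin n → ℂ => ((∑ j, c j * ‖w j‖ ^ 2 : ℝ) : ℂ)) k =
      fun w => (c k : ℂ) * w k := by
    intro k
    funext w
    rw [h1, (HasWirtingerAt.sum Finset.univ fun j _ =>
      ((HasWirtingerAt.coord j).mul (HasWirtingerAt.star_coord j)).const_mul (c j : ℂ)).wirtingerBar_eq]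
    simp [Finset.sum_apply, Pi.single_apply]
  ext j k
  simp only [complexHessian, Matrix.of_apply]
  rw [h2, ((HasWirtingerAt.coord k).const_mul _).wirtinger_eq]
  by_cases hjk : j = k
  · subst hjk; simp
  · simp [hjk]

/-! ### Second derivatives and the complex Hessian -/

theorem pi_eq_sum_re_im {n : ℕ} (u : Fin n → ℂ) :
    u = ∑ j, ((u j).re • (Pi.single j 1 : Fin n → ℂ) +
      (u j).im • (Pi.single j Complex.I : Fin n → ℂ)) := by
  funext i
  rw [Finset.sum_apply, Finset.sum_eq_single i]
  · simp
  · intro j _ hj; simp [hj.symm]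
  · simp

/-- `∂ρ(w) = (dρ(w) - i dρ(iw)) / 2`. -/
theorem sum_delForm_mul {n : ℕ} {f : (Fin n → ℂ) → ℝ} {z : Fin n → ℂ}
    (hf : DifferentiableAt ℝ f z) (w : Fin n → ℂ) :
    ∑ j, delForm f z j * w j =
      (1 / 2 : ℂ) * (fderiv ℝ f z w - Complex.I * fderiv ℝ f z (Complex.I • w)) := by
  have h : fderiv ℝ (fun w => (f w : ℂ)) z = Complex.ofRealCLM.comp (fderiv ℝ f z) :=
    (Complex.ofRealCLM.hasFDerivAt.comp z hf.hasFDerivAt).fderiv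
  have e1 := congrArg (fderiv ℝ f z) (pi_eq_sum_re_im w)
  have e2 := congrArg (fderiv ℝ f z) (pi_eq_sum_re_im (Complex.I • w))
  simp only [map_sum, map_add, map_smul, smul_eq_mul] at e1 e2
  rw [e1, e2]
  push_cast
  rw [Finset.mul_sum, ← Finset.sum_sub_distrib, Finset.mul_sum]
  refine Finset.sum_congr rfl fun j _ => ?_
  simp only [delForm, wirtinger, h]
  apply Complex.ext <;> simp <;> ring

/-- The Levi form in terms of the real second derivative; for a symmetric second derivative and
`w = w'` it is `(D²f(w, w) + D²f(iw, iw)) / 4`. -/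
theorem sesqForm_complexHessian {n : ℕ} {f : (Fin n → ℂ) → ℝ} (hf : ContDiff ℝ 2 f)
    (z w w' : Fin n → ℂ) :
    sesqForm (complexHessian f z) w w' = (1 / 4 : ℂ) *
      (fderiv ℝ (fderiv ℝ f) z w w' + fderiv ℝ (fderiv ℝ f) z (Complex.I • w) (Complex.I • w') +
        Complex.I * (fderiv ℝ (fderiv ℝ f) z w (Complex.I • w') -
          fderiv ℝ (fderiv ℝ f) z (Complex.I • w) w')) := by
  have hd : Differentiable ℝ f := hf.differentiable (by norm_num)
  have hd2 : Differentiable ℝ (fderiv ℝ f) :=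
    (hf.fderiv_right (m := 1) (by norm_num)).differentiable (by norm_num)
  have h : ∀ z, fderiv ℝ (fun w => (f w : ℂ)) z = Complex.ofRealCLM.comp (fderiv ℝ f z) :=
    fun z => (Complex.ofRealCLM.hasFDerivAt.comp z (hd z).hasFDerivAt).fderiv
  have hbar : ∀ k, wirtingerBar (fun w => (f w : ℂ)) k = fun z => (1 / 2 : ℂ) *
      ((fderiv ℝ f z (Pi.single k 1) : ℂ) + Complex.I * (fderiv ℝ f z (Pi.single k Complex.I) : ℂ)) := by
    intro k; funext z; simp [wirtingerBar, h]
  have hap : ∀ v : Fin n → ℂ, HasFDerivAt (fun z => (fderiv ℝ f z v : ℂ))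
      (Complex.ofRealCLM.comp ((fderiv ℝ (fderiv ℝ f) z).flip v)) z := by
    intro v
    refine Complex.ofRealCLM.hasFDerivAt.comp z ?_
    simpa using (hd2 z).hasFDerivAt.clm_apply (hasFDerivAt_const v z)
  set D := fderiv ℝ (fderiv ℝ f) z with hD
  have hent : ∀ j k, complexHessian f z j k = (1 / 4 : ℂ) *
      (D (Pi.single j 1) (Pi.single k 1) + D (Pi.single j Complex.I) (Pi.single k Complex.I) +
        Complex.I * (D (Pi.single j 1) (Pi.single k Complex.I) -
          D (Pi.single j Complex.I) (Pi.single k 1))) := by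
    intro j k
    have h1 := (((hap (Pi.single k 1)).add ((hap (Pi.single k Complex.I)).const_mul Complex.I)).const_mul
      (1 / 2 : ℂ)).fderiv
    simp only [complexHessian, Matrix.of_apply, wirtinger, hbar]
    erw [h1]
    simp
    linear_combination (-(1/4) * (D (Pi.single j Complex.I) (Pi.single k Complex.I) : ℂ)) * Complex.I_mul_I
  have hexp : ∀ u v : Fin n → ℂ, D u v = ∑ j, ∑ k,
      ((u j).re * ((v k).re * D (Pi.single j 1) (Pi.single k 1) +
        (v k).im * D (Pi.single j 1) (Pi.single k Complex.I)) +
      (u j).im * ((v k).re * D (Pi.single j Complex.I) (Pi.single k 1) +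
        (v k).im * D (Pi.single j Complex.I) (Pi.single k Complex.I))) := by
    intro u v
    conv_lhs => rw [pi_eq_sum_re_im u, pi_eq_sum_re_im v]
    simp only [map_sum, map_add, map_smul, smul_eq_mul, sum_apply,
      add_apply, smul_apply]
    conv_rhs => rw [Finset.sum_comm]
    refine Finset.sum_congr rfl fun j _ => ?_
    rw [Finset.mul_sum, Finset.mul_sum, ← Finset.sum_add_distrib]
    exact Finset.sum_congr rfl fun k _ => by ring
  rw [hexp w w', hexp w (Complex.I • w'), hexp (Complex.I • w) w',
    hexp (Complex.I • w) (Complex.I • w')]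
  push_cast
  simp only [← Finset.sum_add_distrib, ← Finset.sum_sub_distrib, Finset.mul_sum, sesqForm]
  refine Finset.sum_congr rfl fun j _ => Finset.sum_congr rfl fun k _ => ?_
  rw [hent]
  apply Complex.ext <;> simp <;> ring

/-! ### Change of the defining function -/

section LevelSets

theorem eq_zero_of_mem_frontier {X : Type*} [TopologicalSpace X] {f : X → ℝ} (hf : Continuous f) {z : X}
    (hz : z ∈ frontier {w | f w < 0}) : f z = 0 :=
  frontier_lt_subset_eq hf continuous_const hz

variable {E : Type*} [NormedAddCommGroup E] [NormedSpace ℝ E]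

theorem eventually_neg_of_hasDerivAt {f : ℝ → ℝ} {c : ℝ} (hf : HasDerivAt f c 0) (h0 : f 0 = 0)
    (hc : c < 0) : ∀ᶠ s in 𝓝[>] (0 : ℝ), f s < 0 := by
  have h1 := hf.tendsto_slope_zero_right
  filter_upwards [h1.eventually (gt_mem_nhds hc), self_mem_nhdsWithin] with s hs hs0
  simp only [zero_add, h0, sub_zero, smul_eq_mul] at hs
  by_contra hcon
  exact absurd hs (not_lt.2 (mul_nonneg (inv_nonneg.2 (Set.mem_Ioi.1 hs0).le) (not_lt.1 hcon)))

theorem hasDerivAt_line {f : E → ℝ} {z : E} (hf : DifferentiableAt ℝ f z) (v : E) :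
    HasDerivAt (fun s : ℝ => f (z + s • v)) (fderiv ℝ f z v) 0 := by
  have h1 : HasDerivAt (fun s : ℝ => z + s • v) v 0 := by
    simpa using ((hasDerivAt_id (0 : ℝ)).smul_const v).const_add z
  exact HasFDerivAt.comp_hasDerivAt (0 : ℝ) (by simpa using hf.hasFDerivAt) h1

/-- A regular point of the zero set of `f` is a boundary point of `{f < 0}`. -/
theorem mem_frontier_of_fderiv_ne_zero {f : E → ℝ} {z : E} (hf : DifferentiableAt ℝ f z)
    (h0 : f z = 0) (hz : fderiv ℝ f z ≠ 0) : z ∈ frontier {w | f w < 0} := by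
  obtain ⟨v, hv⟩ : ∃ v, fderiv ℝ f z v < 0 := by
    obtain ⟨v, hv⟩ := DFunLike.ne_iff.1 hz
    rw [zero_apply] at hv
    rcases lt_or_gt_of_ne hv with h | h
    · exact ⟨v, h⟩
    · exact ⟨-v, by rw [map_neg]; linarith⟩
  refine ⟨?_, fun h => absurd h0 (ne_of_lt (interior_subset (s := {w | f w < 0}) h : f z < 0))⟩
  have h1 := eventually_neg_of_hasDerivAt (hasDerivAt_line hf v) (by simpa using h0) hv
  refine mem_closure_of_tendsto (b := 𝓝[>] (0 : ℝ)) (f := fun s : ℝ => z + s • v) ?_ h1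
  have : Continuous fun s : ℝ => z + s • v := by fun_prop
  simpa using (this.tendsto 0).mono_left nhdsWithin_le_nhds

variable [FiniteDimensional ℝ E]

/-- Tangent vectors of a regular level set are velocities of curves in it. -/
theorem exists_curve_of_mem_ker {f : E → ℝ} (hf : ContDiff ℝ 1 f) {z : E} (h0 : f z = 0)
    (hz : fderiv ℝ f z ≠ 0) {w : E} (hw : fderiv ℝ f z w = 0) :
    ∃ γ : ℝ → E, γ 0 = z ∧ HasDerivAt γ w 0 ∧ ∀ᶠ s in 𝓝 (0 : ℝ), f (γ s) = 0 := by
  have := FiniteDimensional.complete ℝ E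
  have hs : HasStrictFDerivAt f (fderiv ℝ f z) z :=
    hf.contDiffAt.hasStrictFDerivAt (by norm_num)
  have hr : (fderiv ℝ f z).range = ⊤ := by
    rw [LinearMap.range_eq_top]
    exact LinearMap.surjective fun h => hz (by ext v; exact congrArg (fun g => g v) h)
  let w' : (fderiv ℝ f z).ker := ⟨w, hw⟩
  refine ⟨fun s => hs.implicitFunction f _ hr (f z) (s • w'), ?_, ?_, ?_⟩
  · simp
  · have h1 : HasDerivAt (fun s : ℝ => s • w') w' 0 := by
      simpa using (hasDerivAt_id (0 : ℝ)).smul_const w'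
    have h2 := (hs.to_implicitFunction hr).hasFDerivAt
    exact HasFDerivAt.comp_hasDerivAt (0 : ℝ) (by simpa using h2) h1
  · have h1 : Tendsto (fun s : ℝ => (f z, s • w')) (𝓝 0) (𝓝 (f z, 0)) := by
      have : Continuous fun s : ℝ => (f z, s • w') := by fun_prop
      simpa using this.tendsto 0
    filter_upwards [h1.eventually (hs.map_implicitFunction_eq hr)] with s hs
    rw [hs, h0]

/-- At a boundary point, the differentials of two defining functions are positively
proportional. -/
theorem exists_fderiv_eq_smul {f g : E → ℝ} (hf : ContDiff ℝ 1 f) (hg : ContDiff ℝ 1 g)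
    (hfg : {w | f w < 0} = {w | g w < 0}) {z : E} (h0 : f z = 0)
    (hfz : fderiv ℝ f z ≠ 0) (hgz : fderiv ℝ g z ≠ 0) :
    ∃ h : ℝ, 0 < h ∧ fderiv ℝ g z = h • fderiv ℝ f z := by
  have hdf : Differentiable ℝ f := hf.differentiable (by norm_num)
  have hdg : Differentiable ℝ g := hg.differentiable (by norm_num)
  have hg0 : ∀ w, w ∈ frontier {w | f w < 0} → g w = 0 := fun w hw =>
    eq_zero_of_mem_frontier hg.continuous (hfg ▸ hw)
  have hker : ∀ w, fderiv ℝ f z w = 0 → fderiv ℝ g z w = 0 := by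
    intro w hw
    obtain ⟨γ, hγ0, hγ, hγf⟩ := exists_curve_of_mem_ker hf h0 hfz hw
    have hreg : ∀ᶠ s in 𝓝 (0 : ℝ), fderiv ℝ f (γ s) ≠ 0 :=
      ((hf.continuous_fderiv (by norm_num)).continuousAt.comp
        hγ.continuousAt).eventually_ne (by simpa [hγ0] using hfz)
    have hz0 : (fun s => g (γ s)) =ᶠ[𝓝 0] fun _ => (0 : ℝ) := by
      filter_upwards [hγf, hreg] with s h1 h2
      exact hg0 _ (mem_frontier_of_fderiv_ne_zero (hdf _) h1 h2)
    have h1 : HasDerivAt (fun s => g (γ s)) (fderiv ℝ g z w) 0 :=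
      HasFDerivAt.comp_hasDerivAt (0 : ℝ) (by rw [hγ0]; exact (hdg z).hasFDerivAt) hγ
    exact h1.unique ((hasDerivAt_const (0 : ℝ) (0 : ℝ)).congr_of_eventuallyEq hz0)
  obtain ⟨ν, hν⟩ : ∃ ν, fderiv ℝ f z ν = -1 := by
    obtain ⟨v, hv⟩ := DFunLike.ne_iff.1 hfz
    rw [zero_apply] at hv
    exact ⟨(-(fderiv ℝ f z v)⁻¹) • v, by rw [map_smul, smul_eq_mul]; field_simp⟩
  have heq : fderiv ℝ g z = (-fderiv ℝ g z ν) • fderiv ℝ f z := by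
    ext v
    have h1 := hker (v + fderiv ℝ f z v • ν) (by
      rw [map_add, map_smul, hν, smul_eq_mul]; ring)
    rw [map_add, map_smul, smul_eq_mul] at h1
    rw [smul_apply, smul_eq_mul]
    linarith
  refine ⟨_, ?_, heq⟩
  have hne : fderiv ℝ g z ν ≠ 0 := by
    intro h
    rw [h, neg_zero, zero_smul] at heq
    exact hgz heq
  -- `ν` points into `{f < 0} = {g < 0}`, so `g` cannot increase along it.
  rcases lt_or_gt_of_ne hne with h | h
  · linarith
  · exfalso
    have hz0 : g z = 0 := hg0 z (mem_frontier_of_fderiv_ne_zero (hdf z) h0 hfz)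
    have e1 := eventually_neg_of_hasDerivAt (hasDerivAt_line (hdf z) ν) (by simpa using h0)
      (by rw [hν]; norm_num)
    have e2 := eventually_neg_of_hasDerivAt (hasDerivAt_line (hdg z) ν).neg (by simpa using hz0)
      (by linarith)
    obtain ⟨s, h1, h2⟩ := (e1.and e2).exists
    have h3 : z + s • ν ∈ {w | g w < 0} := hfg ▸ h1
    have h4 : g (z + s • ν) < 0 := h3
    simp only [Pi.neg_apply] at h2
    linarith

/-- At a boundary point, the second derivatives of two defining functions are proportional on
tangent vectors, with the same factor as the first derivatives. This is the relation
`dg(v) df(ν) = dg(ν) df(v)`, valid along the boundary, differentiated in a tangent direction. -/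
theorem fderiv_fderiv_eq_mul {f g : E → ℝ} (hf : ContDiff ℝ 2 f) (hg : ContDiff ℝ 2 g)
    (hfg : {w | f w < 0} = {w | g w < 0})
    (hgz : ∀ w ∈ frontier {w | f w < 0}, fderiv ℝ g w ≠ 0) {z : E} (h0 : f z = 0)
    (hfz : fderiv ℝ f z ≠ 0) {h : ℝ} (hh : fderiv ℝ g z = h • fderiv ℝ f z) {w v : E}
    (hw : fderiv ℝ f z w = 0) (hv : fderiv ℝ f z v = 0) :
    fderiv ℝ (fderiv ℝ g) z w v = h * fderiv ℝ (fderiv ℝ f) z w v := by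
  have hf1 : ContDiff ℝ 1 f := hf.of_le (by norm_num)
  have hg1 : ContDiff ℝ 1 g := hg.of_le (by norm_num)
  have hf2 : Differentiable ℝ (fderiv ℝ f) :=
    (hf.fderiv_right (m := 1) (by norm_num)).differentiable (by norm_num)
  have hg2 : Differentiable ℝ (fderiv ℝ g) :=
    (hg.fderiv_right (m := 1) (by norm_num)).differentiable (by norm_num)
  obtain ⟨γ, hγ0, hγ, hγf⟩ := exists_curve_of_mem_ker hf1 h0 hfz hw
  obtain ⟨ν, hν⟩ := DFunLike.ne_iff.1 hfz
  rw [zero_apply] at hν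
  have hreg : ∀ᶠ s in 𝓝 (0 : ℝ), fderiv ℝ f (γ s) ≠ 0 :=
    ((hf1.continuous_fderiv (by norm_num)).continuousAt.comp
      hγ.continuousAt).eventually_ne (by simpa [hγ0] using hfz)
  have hz0 : (fun s => fderiv ℝ g (γ s) v * fderiv ℝ f (γ s) ν) =ᶠ[𝓝 0]
      fun s => fderiv ℝ g (γ s) ν * fderiv ℝ f (γ s) v := by
    filter_upwards [hγf, hreg] with s h1 h2
    obtain ⟨c, -, hc⟩ := exists_fderiv_eq_smul hf1 hg1 hfg h1 h2
      (hgz _ (mem_frontier_of_fderiv_ne_zero (hf1.differentiable (by norm_num) _) h1 h2))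
    simp only [hc, smul_apply, smul_eq_mul]
    ring
  have hder : ∀ {k : E → ℝ}, Differentiable ℝ (fderiv ℝ k) → ∀ u : E,
      HasDerivAt (fun s => fderiv ℝ k (γ s) u) (fderiv ℝ (fderiv ℝ k) z w u) 0 := by
    intro k hk u
    have h1 : HasDerivAt (fun s => fderiv ℝ k (γ s)) (fderiv ℝ (fderiv ℝ k) z w) 0 :=
      HasFDerivAt.comp_hasDerivAt (0 : ℝ) (by rw [hγ0]; exact (hk z).hasFDerivAt) hγ
    simpa using h1.clm_apply (hasDerivAt_const (0 : ℝ) u)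
  have h1 := (((hder hg2 v).mul (hder hf2 ν)).congr_of_eventuallyEq hz0.symm).unique
    ((hder hg2 ν).mul (hder hf2 v))
  simp only [hγ0, hh, smul_apply, smul_eq_mul, hv, mul_zero, zero_mul,
    add_zero, zero_add] at h1
  have h2 : fderiv ℝ f z ν * (fderiv ℝ (fderiv ℝ g) z w v - h * fderiv ℝ (fderiv ℝ f) z w v) = 0 := by
    linear_combination h1
  have h3 := (mul_eq_zero.1 h2).resolve_left hν
  linarith

end LevelSets

theorem delForm_ne_zero {n : ℕ} {f : (Fin n → ℂ) → ℝ} {z : Fin n → ℂ}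
    (hf : DifferentiableAt ℝ f z) (hz : fderiv ℝ f z ≠ 0) : delForm f z ≠ 0 := by
  intro h
  apply hz
  ext w
  have h1 := sum_delForm_mul hf w
  have h2 := congrArg Complex.re h1
  simpa [h] using h2

/-- Weak `Z(q)` does not depend on the choice of the `C²` defining function. -/
theorem SatisfiesWeakZ.weakZAt {n q : ℕ} {k : ℕ∞} {φ : (Fin n → ℂ) → ℝ} {Ω : Set (Fin n → ℂ)}
    (hW : SatisfiesWeakZ k q φ Ω) {ρ : (Fin n → ℂ) → ℝ} (hρ : IsDefiningFunction 2 Ω ρ) :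
    ∃ B : (Fin n → ℂ) → Matrix (Fin n) (Fin n) ℂ, (∀ i j, ContDiff ℝ k fun z => B z i j) ∧
      ∀ z ∈ frontier Ω, WeakZAt q (complexHessian φ z) (complexHessian ρ z) (delForm ρ z) (B z) := by
  obtain ⟨g, ⟨hg, hgΩ, hgz⟩, B, hB, hWz⟩ := hW
  obtain ⟨hf, hfΩ, hfz⟩ := hρ
  replace hf : ContDiff ℝ 2 ρ := hf
  replace hg : ContDiff ℝ 2 g := hg
  refine ⟨B, hB, fun z hz => ?_⟩
  have hfg : {w | ρ w < 0} = {w | g w < 0} := hfΩ.symm.trans hgΩ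
  have hdf : Differentiable ℝ ρ := hf.differentiable (by norm_num)
  have hdg : Differentiable ℝ g := hg.differentiable (by norm_num)
  have h0 : ρ z = 0 := eq_zero_of_mem_frontier hf.continuous (hfΩ ▸ hz)
  obtain ⟨h, hh, hdh⟩ := exists_fderiv_eq_smul (hf.of_le (by norm_num)) (hg.of_le (by norm_num)) hfg
    h0 (hfz z hz) (hgz z hz)
  have htan : ∀ w, ∑ j, delForm ρ z j * w j = 0 →
      fderiv ℝ ρ z w = 0 ∧ fderiv ℝ ρ z (Complex.I • w) = 0 := by
    intro w hw
    rw [sum_delForm_mul (hdf z)] at hw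
    have h1 := congrArg Complex.re hw
    have h2 := congrArg Complex.im hw
    simpa using And.intro h1 h2
  refine (hWz z hz).of_smul hh (delForm_ne_zero (hdf z) (hfz z hz)) (fun j => ?_) ?_
  · have h1 := sum_delForm_mul (hdf z) (Pi.single j 1)
    have h2 := sum_delForm_mul (hdg z) (Pi.single j 1)
    simp only [Pi.single_apply, mul_ite, mul_one, mul_zero, Finset.sum_ite_eq', Finset.mem_univ,
      if_true] at h1 h2
    rw [h1, h2, hdh]
    simp only [smul_apply, smul_eq_mul]
    push_cast
    ring
  · intro w w' hw hw'
    obtain ⟨a1, a2⟩ := htan w hw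
    obtain ⟨b1, b2⟩ := htan w' hw'
    have key : ∀ u v, fderiv ℝ ρ z u = 0 → fderiv ℝ ρ z v = 0 →
        fderiv ℝ (fderiv ℝ g) z u v = h * fderiv ℝ (fderiv ℝ ρ) z u v := fun u v hu hv =>
      fderiv_fderiv_eq_mul hf hg hfg (fun y hy => hgz y (by rw [hfΩ]; exact hy)) h0 (hfz z hz) hdh
        hu hv
    rw [sesqForm_complexHessian hf, sesqForm_complexHessian hg, key _ _ a1 b1, key _ _ a2 b2,
      key _ _ a1 b2, key _ _ a2 b1]
    push_cast
    ring

/-! ### The domain -/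

/-- The defining function `|z₄|² - 9x² + 12xy + y² + 96x³ - 1`, with `x = |z₁|²` and
`y = |z₂|² + |z₃|²`. -/
noncomputable def quarticRho (z : Fin 4 → ℂ) : ℝ :=
  ‖z 3‖ ^ 2 + (-9 * (‖z 0‖ ^ 2) ^ 2 + 12 * ‖z 0‖ ^ 2 * (‖z 1‖ ^ 2 + ‖z 2‖ ^ 2) +
    (‖z 1‖ ^ 2 + ‖z 2‖ ^ 2) ^ 2 + 96 * (‖z 0‖ ^ 2) ^ 3) - 1

/-- The domain `{quarticRho < 0}`. -/
def quarticDomain : Set (Fin 4 → ℂ) := {z | quarticRho z < 0}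

theorem contDiff_normSq_coord {n : ℕ} (j : Fin n) {m : WithTop ℕ∞} :
    ContDiff ℝ m fun z : Fin n → ℂ => ‖z j‖ ^ 2 :=
  (contDiff_apply ℝ ℂ j).norm_sq ℝ

theorem contDiff_quarticRho {m : WithTop ℕ∞} : ContDiff ℝ m quarticRho := by
  have h := fun j => contDiff_normSq_coord (n := 4) j (m := m)
  unfold quarticRho
  exact ((h 3).add (((((contDiff_const.mul ((h 0).pow 2)).add ((contDiff_const.mul (h 0)).mul
    ((h 1).add (h 2)))).add (((h 1).add (h 2)).pow 2)).add (contDiff_const.mul ((h 0).pow 3))))).sub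
    contDiff_const

/-- The real functions `c_k` with `∂ρ/∂z̄_k = c_k z_k`. -/
noncomputable def quarticCoeff (z : Fin 4 → ℂ) : Fin 4 → ℝ :=
  ![-18 * ‖z 0‖ ^ 2 + 12 * (‖z 1‖ ^ 2 + ‖z 2‖ ^ 2) + 288 * (‖z 0‖ ^ 2) ^ 2,
    12 * ‖z 0‖ ^ 2 + 2 * (‖z 1‖ ^ 2 + ‖z 2‖ ^ 2), 12 * ‖z 0‖ ^ 2 + 2 * (‖z 1‖ ^ 2 + ‖z 2‖ ^ 2), 1]

theorem hasWirtingerAt_normSq_coord {n : ℕ} (i : Fin n) (z : Fin n → ℂ) :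
    HasWirtingerAt (fun w => w i * star (w i)) (star (z i) • Pi.single i 1)
      (z i • Pi.single i 1) z := by
  simpa using (HasWirtingerAt.coord (z := z) i).mul (HasWirtingerAt.star_coord i)

theorem ofReal_norm_sq (c : ℂ) : ((‖c‖ : ℂ)) ^ 2 = c * star c := by
  rw [Complex.star_def, Complex.mul_conj']

theorem hasWirtingerAt_quarticRho (z : Fin 4 → ℂ) :
    HasWirtingerAt (fun w => (quarticRho w : ℂ)) (fun k => quarticCoeff z k * star (z k))
      (fun k => quarticCoeff z k * z k) z := by
  have h := fun i => hasWirtingerAt_normSq_coord i z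
  have hY := (h 1).add (h 2)
  have h1 := ((h 3).add ((((((h 0).mul (h 0)).const_mul (-9)).add (((h 0).const_mul 12).mul hY)).add
    (hY.mul hY)).add ((((h 0).mul (h 0)).mul (h 0)).const_mul 96))).add (HasWirtingerAt.const (-1))
  convert h1 using 1
  · funext w
    simp only [quarticRho]
    push_cast
    simp only [ofReal_norm_sq]
    ring
  · funext k
    fin_cases k <;> simp [quarticCoeff, ← Complex.mul_conj'] <;> ring
  · funext k
    fin_cases k <;> simp [quarticCoeff, ← Complex.mul_conj'] <;> ring

theorem delForm_quarticRho (z : Fin 4 → ℂ) :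
    delForm quarticRho z = fun k => quarticCoeff z k * star (z k) := by
  funext k
  exact (hasWirtingerAt_quarticRho z).wirtinger_eq k

theorem complexHessian_quarticRho (z : Fin 4 → ℂ) :
    complexHessian quarticRho z =
      !![-36 * (‖z 0‖ : ℂ) ^ 2 + 12 * ((‖z 1‖ : ℂ) ^ 2 + (‖z 2‖ : ℂ) ^ 2) + 864 * ((‖z 0‖ : ℂ) ^ 2) ^ 2,
          12 * star (z 0) * z 1, 12 * star (z 0) * z 2, 0;
        12 * star (z 1) * z 0, 12 * (‖z 0‖ : ℂ) ^ 2 + 2 * ((‖z 1‖ : ℂ) ^ 2 + (‖z 2‖ : ℂ) ^ 2) + 2 * (‖z 1‖ : ℂ) ^ 2,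
          2 * star (z 1) * z 2, 0;
        12 * star (z 2) * z 0, 2 * star (z 2) * z 1,
          12 * (‖z 0‖ : ℂ) ^ 2 + 2 * ((‖z 1‖ : ℂ) ^ 2 + (‖z 2‖ : ℂ) ^ 2) + 2 * (‖z 2‖ : ℂ) ^ 2, 0;
        0, 0, 0, (1 : ℂ)] := by
  have hbar : ∀ k, wirtingerBar (fun w => (quarticRho w : ℂ)) k =
      fun w => (quarticCoeff w k : ℂ) * w k := fun k => by
    funext w; exact (hasWirtingerAt_quarticRho w).wirtingerBar_eq k
  have h := fun i => hasWirtingerAt_normSq_coord i z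
  have hY := (h 1).add (h 2)
  have c0 := (((h 0).const_mul (-18)).add (hY.const_mul 12)).add (((h 0).mul (h 0)).const_mul 288)
  have c1 := ((h 0).const_mul 12).add (hY.const_mul 2)
  have e0 : (fun w : Fin 4 → ℂ => (quarticCoeff w 0 : ℂ) * w 0) = fun w =>
      (-18 * (w 0 * star (w 0)) + 12 * (w 1 * star (w 1) + w 2 * star (w 2)) +
        288 * (w 0 * star (w 0) * (w 0 * star (w 0)))) * w 0 := by
    funext w
    simp only [quarticCoeff, Matrix.cons_val]
    push_cast
    simp only [ofReal_norm_sq]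
    ring
  have e1 : (fun w : Fin 4 → ℂ => (quarticCoeff w 1 : ℂ) * w 1) = fun w =>
      (12 * (w 0 * star (w 0)) + 2 * (w 1 * star (w 1) + w 2 * star (w 2))) * w 1 := by
    funext w
    simp only [quarticCoeff, Matrix.cons_val]
    push_cast
    simp only [ofReal_norm_sq]
  have e2 : (fun w : Fin 4 → ℂ => (quarticCoeff w 2 : ℂ) * w 2) = fun w =>
      (12 * (w 0 * star (w 0)) + 2 * (w 1 * star (w 1) + w 2 * star (w 2))) * w 2 := by
    funext w
    simp only [quarticCoeff, Matrix.cons_val]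
    push_cast
    simp only [ofReal_norm_sq]
  have e3 : (fun w : Fin 4 → ℂ => (quarticCoeff w 3 : ℂ) * w 3) = fun w => w 3 := by
    funext w; simp [quarticCoeff]
  have H0 : ∀ j, complexHessian quarticRho z j 0 = _ := fun j => by
    simp only [complexHessian, Matrix.of_apply, hbar, e0]
    exact (c0.mul (HasWirtingerAt.coord 0)).wirtinger_eq j
  have H1 : ∀ j, complexHessian quarticRho z j 1 = _ := fun j => by
    simp only [complexHessian, Matrix.of_apply, hbar, e1]
    exact (c1.mul (HasWirtingerAt.coord 1)).wirtinger_eq j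
  have H2 : ∀ j, complexHessian quarticRho z j 2 = _ := fun j => by
    simp only [complexHessian, Matrix.of_apply, hbar, e2]
    exact (c1.mul (HasWirtingerAt.coord 2)).wirtinger_eq j
  have H3 : ∀ j, complexHessian quarticRho z j 3 = _ := fun j => by
    simp only [complexHessian, Matrix.of_apply, hbar, e3]
    exact (HasWirtingerAt.coord 3).wirtinger_eq j
  ext j k
  fin_cases k
  · refine (H0 j).trans ?_
    fin_cases j <;> simp [← Complex.mul_conj'] <;> ring
  · refine (H1 j).trans ?_
    fin_cases j <;> simp [← Complex.mul_conj'] <;> ring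
  · refine (H2 j).trans ?_
    fin_cases j <;> simp [← Complex.mul_conj'] <;> ring
  · refine (H3 j).trans ?_
    fin_cases j <;> simp

theorem fderiv_quarticRho_ne_zero {z : Fin 4 → ℂ} (hz : quarticRho z = 0) :
    fderiv ℝ quarticRho z ≠ 0 := by
  intro h0
  have hd : ∀ w : Fin 4 → ℂ, ∑ j, delForm quarticRho z j * w j = 0 := fun w => by
    rw [sum_delForm_mul (contDiff_quarticRho (m := 1).differentiable (by norm_num) z), h0]
    simp
  -- Pairing `∂ρ` with `(0, 0, 0, z₄)` gives `z₄ = 0`, and pairing it with `(z₁, z₂, z₃, 0)` gives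
  -- `2F₄ + 3F₆ = 0` for the quartic and sextic parts of `ρ`, against `F₄ + F₆ = 1` and `F₆ ≥ 0`.
  have h1 := hd ![0, 0, 0, z 3]
  have h2 := hd ![z 0, z 1, z 2, 0]
  simp only [delForm_quarticRho, Fin.sum_univ_four] at h1 h2
  simp [quarticCoeff, -map_eq_zero] at h1 h2
  have h2' : (-18 * ‖z 0‖ ^ 2 + 12 * (‖z 1‖ ^ 2 + ‖z 2‖ ^ 2) + 288 * (‖z 0‖ ^ 2) ^ 2) * ‖z 0‖ ^ 2 +
      (12 * ‖z 0‖ ^ 2 + 2 * (‖z 1‖ ^ 2 + ‖z 2‖ ^ 2)) * ‖z 1‖ ^ 2 +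
      (12 * ‖z 0‖ ^ 2 + 2 * (‖z 1‖ ^ 2 + ‖z 2‖ ^ 2)) * ‖z 2‖ ^ 2 = 0 := by
    rw [← Complex.ofReal_inj]
    push_cast
    rw [← h2]
    simp only [← Complex.mul_conj']
    ring
  have h3 : ‖z 3‖ = 0 := by simpa using h1
  simp only [quarticRho, h3] at hz
  nlinarith [pow_nonneg (sq_nonneg ‖z 0‖) 3]

theorem isDefiningFunction_quarticRho (m : ℕ∞) :
    IsDefiningFunction m quarticDomain quarticRho :=
  ⟨contDiff_quarticRho, rfl, fun _ hz => fderiv_quarticRho_ne_zero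
    (eq_zero_of_mem_frontier (contDiff_quarticRho (m := 0)).continuous hz)⟩

theorem mem_frontier_quarticDomain {z : Fin 4 → ℂ} (hz : quarticRho z = 0) :
    z ∈ frontier quarticDomain :=
  mem_frontier_of_fderiv_ne_zero ((contDiff_quarticRho (m := 1)).differentiable (by norm_num) z) hz
    (fderiv_quarticRho_ne_zero hz)

theorem isBounded_quarticDomain : Bornology.IsBounded quarticDomain := by
  refine (Metric.isBounded_closedBall (x := (0 : Fin 4 → ℂ)) (r := 2)).subset fun z hz => ?_
  rw [mem_closedBall_zero_iff, pi_norm_le_iff_of_nonneg (by norm_num)]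
  have hz' : quarticRho z < 0 := hz
  simp only [quarticRho] at hz'
  have hx := sq_nonneg ‖z 0‖
  have hy := sq_nonneg ‖z 1‖
  have hy' := sq_nonneg ‖z 2‖
  have hp := sq_nonneg ‖z 3‖
  set x := ‖z 0‖ ^ 2
  set y := ‖z 1‖ ^ 2
  set y' := ‖z 2‖ ^ 2
  set p := ‖z 3‖ ^ 2
  have hxy : 0 ≤ x * (y + y') := by positivity
  have h1 : x - 1 ≤ -9 * x ^ 2 + 96 * x ^ 3 := by
    nlinarith [mul_nonneg hx (sq_nonneg (8 * x - 1)), sq_nonneg (8 * x - 1), sq_nonneg x]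
  have h2 : 2 * (y + y') - 1 ≤ (y + y') ^ 2 := by nlinarith [sq_nonneg (y + y' - 1)]
  have hle : ∀ a : ℝ, a ^ 2 ≤ 4 → a ≤ 2 := fun a ha => by nlinarith
  intro i
  apply hle
  fin_cases i
  · show x ≤ 4; linarith
  · show y ≤ 4; linarith
  · show y' ≤ 4; linarith
  · show p ≤ 4; linarith

theorem quarticRho_zero : quarticRho 0 = -1 := by simp [quarticRho]

/-- Every point is joined to the origin inside the domain: first the last coordinate is shrunk, then
the others. Along the second segment the quartic part may be negative, but then `quarticRho` first
decreases and then increases. -/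
theorem isConnected_quarticDomain : IsConnected quarticDomain := by
  have h0 : (0 : Fin 4 → ℂ) ∈ quarticDomain := by
    show quarticRho 0 < 0; rw [quarticRho_zero]; norm_num
  refine IsPathConnected.isConnected ⟨0, h0, fun {z} hz => ?_⟩
  have hz' : quarticRho z < 0 := hz
  have hp := sq_nonneg ‖z 3‖
  have hx := pow_nonneg (sq_nonneg ‖z 0‖) 3
  simp only [quarticRho] at hz'
  set F4 := -9 * (‖z 0‖ ^ 2) ^ 2 + 12 * ‖z 0‖ ^ 2 * (‖z 1‖ ^ 2 + ‖z 2‖ ^ 2) +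
    (‖z 1‖ ^ 2 + ‖z 2‖ ^ 2) ^ 2 with hF4
  set F6 := 96 * (‖z 0‖ ^ 2) ^ 3 with hF6
  have e1 : ∀ s : ℝ, quarticRho (![s * z 0, s * z 1, s * z 2, 0]) =
      s ^ 4 * F4 + s ^ 6 * F6 - 1 := by
    intro s
    simp only [quarticRho, hF4, hF6]
    simp [mul_pow]
    ring
  have e2 : ∀ s : ℝ, quarticRho (![z 0, z 1, z 2, s * z 3]) = s ^ 2 * ‖z 3‖ ^ 2 + (F4 + F6) - 1 := by
    intro s
    simp only [quarticRho, hF4, hF6]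
    simp [mul_pow]
  have j1 : JoinedIn quarticDomain 0 ![z 0, z 1, z 2, 0] := by
    refine JoinedIn.ofLine (f := fun s : ℝ => ![s * z 0, s * z 1, s * z 2, 0]) ?_ (by ext i; fin_cases i <;> simp)
      (by simp) ?_
    · refine Continuous.continuousOn (continuous_pi fun i => ?_)
      fin_cases i <;> simp <;> fun_prop
    · rintro _ ⟨s, ⟨hs0, hs1⟩, rfl⟩
      show quarticRho _ < 0
      rw [e1]
      have hs4 : 0 ≤ s ^ 4 := by positivity
      have hs41 : s ^ 4 ≤ 1 := pow_le_one₀ hs0 hs1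
      have hs2 : s ^ 2 ≤ 1 := pow_le_one₀ hs0 hs1
      have hF : 0 ≤ F6 := by rw [hF6]; linarith
      have h3 : s ^ 4 * F4 + s ^ 6 * F6 ≤ s ^ 4 * (F4 + F6) := by
        have : s ^ 6 * F6 = s ^ 4 * (s ^ 2 * F6) := by ring
        rw [this, ← mul_add]
        exact mul_le_mul_of_nonneg_left (by nlinarith) hs4
      rcases le_total (F4 + F6) 0 with h | h <;> nlinarith
  have j2 : JoinedIn quarticDomain ![z 0, z 1, z 2, 0] z := by
    refine JoinedIn.ofLine (f := fun s : ℝ => ![z 0, z 1, z 2, s * z 3]) ?_ (by simp)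
      (by ext i; fin_cases i <;> simp) ?_
    · refine Continuous.continuousOn (continuous_pi fun i => ?_)
      fin_cases i <;> simp <;> fun_prop
    · rintro _ ⟨s, ⟨hs0, hs1⟩, rfl⟩
      show quarticRho _ < 0
      rw [e2]
      have hs2 : s ^ 2 ≤ 1 := pow_le_one₀ hs0 hs1
      nlinarith
  exact j1.trans j2

theorem isSmoothBoundedDomain_quarticDomain : IsSmoothBoundedDomain quarticDomain :=
  ⟨isOpen_lt (contDiff_quarticRho (m := 0)).continuous continuous_const, isConnected_quarticDomain,
    isBounded_quarticDomain, quarticRho, isDefiningFunction_quarticRho ⊤⟩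

/-! ### The metrics `ω_t` -/

theorem sesqForm_diagonal {n : ℕ} (c : Fin n → ℂ) (u v : Fin n → ℂ) :
    sesqForm (Matrix.diagonal c) u v = ∑ j, c j * u j * star (v j) := by
  simp only [sesqForm]
  refine Finset.sum_congr rfl fun j _ => ?_
  rw [Finset.sum_eq_single j]
  · simp
  · intro k _ hk; simp [Matrix.diagonal_apply_ne _ hk.symm]
  · simp

theorem sesqForm_diagonal_self_re {n : ℕ} (c : Fin n → ℝ) (u : Fin n → ℂ) :
    (sesqForm (Matrix.diagonal fun j => (c j : ℂ)) u u).re = ∑ j, c j * ‖u j‖ ^ 2 := by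
  rw [sesqForm_diagonal, Complex.re_sum]
  refine Finset.sum_congr rfl fun j _ => ?_
  rw [mul_assoc, ← ofReal_norm_sq, Complex.re_ofReal_mul]
  norm_cast

/-- Bessel's inequality for two orthonormal vectors and the `i`-th coordinate vector. -/
theorem bessel_diagonal {n : ℕ} {c : Fin n → ℝ} (hc : ∀ j, 0 ≤ c j) {u v : Fin n → ℂ}
    (huu : sesqForm (Matrix.diagonal fun j => (c j : ℂ)) u u = 1)
    (hvv : sesqForm (Matrix.diagonal fun j => (c j : ℂ)) v v = 1)
    (huv : sesqForm (Matrix.diagonal fun j => (c j : ℂ)) u v = 0)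
    (hvu : sesqForm (Matrix.diagonal fun j => (c j : ℂ)) v u = 0) (i : Fin n) :
    c i * (‖u i‖ ^ 2 + ‖v i‖ ^ 2) ≤ 1 := by
  set G := Matrix.diagonal fun j => (c j : ℂ) with hG
  set S := ‖u i‖ ^ 2 + ‖v i‖ ^ 2 with hS
  -- `w` represents the `i`-th coordinate on the span of `u` and `v`.
  set w := star (u i) • u + star (v i) • v with hw
  have h1 : (sesqForm G w w).re = S := by
    have : sesqForm G w w = (S : ℂ) := by
      simp only [hw, sesqForm_add_left, sesqForm_add_right, sesqForm_smul_left,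
        sesqForm_smul_right, huu, hvv, huv, hvu, star_star, hS]
      push_cast
      simp only [ofReal_norm_sq]
      ring
    rw [this, Complex.ofReal_re]
  have h2 : w i = (S : ℂ) := by
    simp only [hw, Pi.add_apply, Pi.smul_apply, smul_eq_mul, hS]
    push_cast
    simp only [ofReal_norm_sq]
    ring
  have hS0 : 0 ≤ S := by positivity
  have h3 : c i * S ^ 2 ≤ S := by
    calc c i * S ^ 2 = c i * ‖w i‖ ^ 2 := by rw [h2, Complex.norm_real, Real.norm_eq_abs, sq_abs]
      _ ≤ ∑ j, c j * ‖w j‖ ^ 2 := Finset.single_le_sum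
          (f := fun j => c j * ‖w j‖ ^ 2) (fun j _ => mul_nonneg (hc j) (sq_nonneg _))
          (Finset.mem_univ i)
      _ = S := by rw [← sesqForm_diagonal_self_re, h1]
  rcases hS0.eq_or_lt with h | h
  · rw [← h, mul_zero]; exact zero_le_one
  · nlinarith

theorem potential_eq_sum (t : ℝ) :
    potential t = fun z => ∑ j, (![t, 1, 1, 1] : Fin 4 → ℝ) j * ‖z j‖ ^ 2 := by
  funext z
  simp [potential, Fin.sum_univ_four]

theorem complexHessian_potential (t : ℝ) (z : Fin 4 → ℂ) :
    complexHessian (potential t) z =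
      Matrix.diagonal fun j => ((![t, 1, 1, 1] : Fin 4 → ℝ) j : ℂ) := by
  rw [potential_eq_sum, complexHessian_sum_mul_normSq]

theorem weights_pos {t : ℝ} (ht : 6 ≤ t) (j : Fin 4) : 0 < (![t, 1, 1, 1] : Fin 4 → ℝ) j := by
  fin_cases j <;> simp; linarith

theorem isStrictlyPshExhaustion_potential {t : ℝ} (ht : 6 ≤ t) :
    IsStrictlyPshExhaustion (potential t) := by
  have hcd : ContDiff ℝ ∞ (potential t) := by
    rw [potential_eq_sum]
    exact ContDiff.sum fun j _ => contDiff_const.mul (contDiff_normSq_coord j)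
  refine ⟨hcd, fun z => ?_, fun c => ?_⟩
  · rw [complexHessian_potential]
    exact Matrix.PosDef.diagonal fun j => by exact_mod_cast weights_pos ht j
  · refine Metric.isCompact_of_isClosed_isBounded (isClosed_le hcd.continuous continuous_const)
      ((Metric.isBounded_closedBall (x := (0 : Fin 4 → ℂ)) (r := |c| + 1)).subset fun z hz => ?_)
    rw [mem_closedBall_zero_iff, pi_norm_le_iff_of_nonneg (by positivity)]
    have hz' : potential t z ≤ c := hz
    simp only [potential] at hz'
    have hc := le_abs_self c
    have hc0 := abs_nonneg c
    have h0 := sq_nonneg ‖z 0‖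
    have h1 := sq_nonneg ‖z 1‖
    have h2 := sq_nonneg ‖z 2‖
    have h3 := sq_nonneg ‖z 3‖
    have h0t : ‖z 0‖ ^ 2 ≤ t * ‖z 0‖ ^ 2 := by nlinarith
    have hle : ∀ a : ℝ, a ^ 2 ≤ c → a ≤ |c| + 1 := fun a ha => by nlinarith
    intro i
    apply hle
    fin_cases i
    · show ‖z 0‖ ^ 2 ≤ c; linarith
    · show ‖z 1‖ ^ 2 ≤ c; linarith
    · show ‖z 2‖ ^ 2 ≤ c; linarith
    · show ‖z 3‖ ^ 2 ≤ c; linarith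

/-- Completing the square absorbs the mixed terms of the Hessian. -/
theorem sesqForm_complexHessian_quarticRho_re (z w : Fin 4 → ℂ) :
    (sesqForm (complexHessian quarticRho z) w w).re =
      ‖w 3‖ ^ 2 + (-72 * ‖z 0‖ ^ 2 + 12 * (‖z 1‖ ^ 2 + ‖z 2‖ ^ 2) + 864 * (‖z 0‖ ^ 2) ^ 2) * ‖w 0‖ ^ 2
        + 12 * ‖z 0‖ ^ 2 * (‖w 1‖ ^ 2 + ‖w 2‖ ^ 2) + 2 * ‖z 1 * w 2 - z 2 * w 1‖ ^ 2
        + ‖6 * (star (z 0) * w 0) + 2 * (star (z 1) * w 1 + star (z 2) * w 2)‖ ^ 2 := by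
  rw [complexHessian_quarticRho]
  simp only [sesqForm, Fin.sum_univ_four, ofReal_norm_sq, ← Complex.normSq_eq_norm_sq,
    Complex.normSq_apply]
  simp [pow_two]
  ring

/-- For a pair of `ω_t`-orthonormal vectors the sum of the values of the Hessian of `ρ` is
nonnegative. By Bessel's inequality the pair carries at most the weight `1` in the direction of the
first coordinate, the only one in which the Hessian can be negative, and the factor `t ≥ 6` tames
the coefficient `-72`. -/
theorem hessian_pair_nonneg {t : ℝ} (ht : 6 ≤ t) (z : Fin 4 → ℂ) {u v : Fin 4 → ℂ}
    (huu : sesqForm (complexHessian (potential t) z) u u = 1)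
    (hvv : sesqForm (complexHessian (potential t) z) v v = 1)
    (huv : sesqForm (complexHessian (potential t) z) u v = 0)
    (hvu : sesqForm (complexHessian (potential t) z) v u = 0) :
    0 ≤ (sesqForm (complexHessian quarticRho z) u u).re +
      (sesqForm (complexHessian quarticRho z) v v).re := by
  rw [complexHessian_potential] at huu hvv huv hvu
  have hb := bessel_diagonal (fun j => (weights_pos ht j).le) huu hvv huv hvu 0
  have hu := sesqForm_diagonal_self_re ![t, 1, 1, 1] u
  have hv := sesqForm_diagonal_self_re ![t, 1, 1, 1] v
  rw [huu] at hu
  rw [hvv] at hv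
  simp only [Fin.sum_univ_four, Complex.one_re, Matrix.cons_val] at hu hv hb
  set x := ‖z 0‖ ^ 2 with hx
  have hx0 : 0 ≤ x := sq_nonneg _
  have hlow : ∀ w : Fin 4 → ℂ,
      ‖w 3‖ ^ 2 + (-72 * x + 864 * x ^ 2) * ‖w 0‖ ^ 2 + 12 * x * (‖w 1‖ ^ 2 + ‖w 2‖ ^ 2) ≤
        (sesqForm (complexHessian quarticRho z) w w).re := by
    intro w
    rw [sesqForm_complexHessian_quarticRho_re]
    have : 0 ≤ 12 * (‖z 1‖ ^ 2 + ‖z 2‖ ^ 2) * ‖w 0‖ ^ 2 := by positivity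
    have h2 := sq_nonneg ‖z 1 * w 2 - z 2 * w 1‖
    have h3 := sq_nonneg ‖6 * (star (z 0) * w 0) + 2 * (star (z 1) * w 1 + star (z 2) * w 2)‖
    nlinarith
  have hlu := hlow u
  have hlv := hlow v
  refine le_trans ?_ (add_le_add hlu hlv)
  have hU0 := sq_nonneg ‖u 0‖
  have hV0 := sq_nonneg ‖v 0‖
  have hU3 := sq_nonneg ‖u 3‖
  have hV3 := sq_nonneg ‖v 3‖
  -- For `12x ≤ 1` the coefficient of `‖w 3‖ ^ 2` is at least that of `‖w 1‖ ^ 2` and `‖w 2‖ ^ 2`;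
  -- for `12x ≥ 1` the sextic term makes the coefficient of `‖w 0‖ ^ 2` nonnegative.
  rcases le_total (12 * x) 1 with h12 | h12
  · have a1 : 12 * x * (‖u 3‖ ^ 2 + ‖v 3‖ ^ 2) ≤ ‖u 3‖ ^ 2 + ‖v 3‖ ^ 2 :=
      mul_le_of_le_one_left (by positivity) h12
    have a2 : 0 ≤ 864 * x ^ 2 * (‖u 0‖ ^ 2 + ‖v 0‖ ^ 2) := by positivity
    have a3 : 6 * (‖u 0‖ ^ 2 + ‖v 0‖ ^ 2) ≤ t * (‖u 0‖ ^ 2 + ‖v 0‖ ^ 2) :=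
      mul_le_mul_of_nonneg_right ht (by positivity)
    have a4 : 0 ≤ 12 * x * (‖u 1‖ ^ 2 + ‖u 2‖ ^ 2 + ‖u 3‖ ^ 2 + ‖v 1‖ ^ 2 + ‖v 2‖ ^ 2 + ‖v 3‖ ^ 2 -
        6 * (‖u 0‖ ^ 2 + ‖v 0‖ ^ 2)) := mul_nonneg (by positivity) (by linarith)
    linarith
  · have a1 : 0 ≤ -72 * x + 864 * x ^ 2 := by nlinarith
    positivity

/-- The field `Υ = 0` witnesses weak `Z(2)`: the sum of the two smallest eigenvalues of the Levi form
with respect to `ω_t` is nonnegative. -/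
theorem satisfiesWeakZ_potential {t : ℝ} (ht : 6 ≤ t) (k : ℕ∞) :
    SatisfiesWeakZ k 2 (potential t) quarticDomain := by
  refine ⟨quarticRho, isDefiningFunction_quarticRho 2, fun _ => 0, fun i j => contDiff_const,
    fun z _ => ⟨⟨Matrix.isHermitian_zero, by simp⟩, fun θ _ => ?_, fun μ hμ => ?_, ?_⟩⟩
  · have hinv : (complexHessian (potential t) z)⁻¹ =
        Matrix.diagonal fun j => (((![t, 1, 1, 1] : Fin 4 → ℝ) j)⁻¹ : ℂ) := by
      refine Matrix.inv_eq_right_inv ?_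
      rw [complexHessian_potential, Matrix.diagonal_mul_diagonal, ← Matrix.diagonal_one]
      congr 1
      funext j
      exact mul_inv_cancel₀ (by exact_mod_cast (weights_pos ht j).ne')
    have h1 : copairing (complexHessian (potential t) z)⁻¹ θ θ =
        sesqForm (Matrix.diagonal fun j => ((((![t, 1, 1, 1] : Fin 4 → ℝ) j)⁻¹ : ℝ) : ℂ)) θ θ := by
      rw [hinv]
      simp only [copairing, sesqForm]
      refine Finset.sum_congr rfl fun i _ => Finset.sum_congr rfl fun k _ => ?_
      by_cases hik : i = k
      · subst hik; simp
      · simp [hik, Ne.symm hik]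
    rw [h1, sesqForm_diagonal_self_re]
    have h2 : copairing (0 : Matrix (Fin 4) (Fin 4) ℂ) θ θ = 0 := by simp [copairing]
    rw [h2]
    exact ⟨le_rfl, Finset.sum_nonneg fun j _ =>
      mul_nonneg (inv_nonneg.2 (weights_pos ht j).le) (sq_nonneg _)⟩
  · obtain ⟨-, u, -, hG, hH⟩ := hμ
    have h1 := hessian_pair_nonneg ht z (u := u (0 : Fin 3)) (v := u (1 : Fin 3))
      (by simpa using hG (0 : Fin 3) (0 : Fin 3)) (by simpa using hG (1 : Fin 3) (1 : Fin 3))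
      (by simpa using hG (0 : Fin 3) (1 : Fin 3)) (by simpa using hG (1 : Fin 3) (0 : Fin 3))
    rw [hH, hH] at h1
    have h2 : (∑ i : Fin (4 - 1) with i.val < 2, μ i) = μ (0 : Fin 3) + μ (1 : Fin 3) := by
      show (∑ i : Fin 3 with i.val < 2, μ i) = _
      rw [Finset.sum_filter, Fin.sum_univ_three]
      simp
    rw [h2]
    simpa [pairing11] using h1
  · simp [pairing11]

/-! ### Failure of weak `Z(2)` for the Euclidean metric -/

theorem complexHessian_euclidean (z : Fin 4 → ℂ) :
    complexHessian (fun w : Fin 4 → ℂ => ∑ j, ‖w j‖ ^ 2) z = 1 := by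
  have h := complexHessian_sum_mul_normSq (fun _ : Fin 4 => (1 : ℝ)) z
  simpa using h

theorem nonneg_diag_of_weakZAt {n q : ℕ} {H B : Matrix (Fin n) (Fin n) ℂ} {d : Fin n → ℂ}
    (hW : WeakZAt q 1 H d B) {j : Fin n} (hj : d j = 0) : 0 ≤ (B j j).re := by
  have h1 : ∀ (C : Matrix (Fin n) (Fin n) ℂ) (θ : Fin n → ℂ),
      copairing C (Pi.single j 1) θ = ∑ k, C k j * star (θ k) := by
    intro C θ
    simp only [copairing]
    rw [Finset.sum_eq_single j]
    · simp
    · intro b _ hb; simp [hb]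
    · simp
  have h2 := (hW.2.1 (Pi.single j 1) (by rw [h1]; simp [Matrix.one_apply, hj])).1
  rw [h1] at h2
  simpa [Pi.single_apply] using h2

theorem pairing11_diagonal {n : ℕ} (h : Fin n → ℝ) (B : Matrix (Fin n) (Fin n) ℂ) :
    pairing11 (Matrix.diagonal fun j => (h j : ℂ)) B = ∑ j, h j * (B j j).re := by
  simp only [pairing11, Complex.re_sum]
  refine Finset.sum_congr rfl fun j _ => ?_
  rw [Finset.sum_eq_single j]
  · simp [mul_comm]
  · intro k _ hk; simp [Matrix.diagonal_apply_ne _ hk.symm]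
  · simp

/-- If the conormal has only the components `α` and `r ≠ 0` in the directions `i` and `l`, then the
component of a tangential field in the direction `l` is determined by that in the direction `i`. -/
theorem diag_eq_of_tangential {n : ℕ} {B : Matrix (Fin n) (Fin n) ℂ} {d : Fin n → ℂ}
    (hB : IsTangentialReal B d) {i l : Fin n} {α r : ℝ} (hr : r ≠ 0)
    (hd : ∀ k, ∑ j, B k j * d j = B k i * α + B k l * r) :
    (B l l).re = (B i i).re * (α ^ 2 / r ^ 2) := by
  have h1 := (hd i).symm.trans (hB.2 i)
  have h2 := (hd l).symm.trans (hB.2 l)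
  have h3 := hB.1.apply i l
  have e1 := congrArg Complex.re h1
  have e2 := congrArg Complex.re h2
  rw [← h3] at e1
  simp at e1 e2
  field_simp
  linear_combination r * e2 - α * e1

/-- The inequality of weak `Z(2)` at a point `(ε, 0, 0, *)`. The eigenvectors of the Levi form are
`(r, 0, 0, -α)`, up to normalization, and the second and third coordinate vectors. -/
theorem weakZAt_axis_zero {B : Matrix (Fin 4) (Fin 4) ℂ} {α r a b : ℝ} (hr : r ≠ 0)
    (hab : (r ^ 2 * a + α ^ 2) / (r ^ 2 + α ^ 2) ≤ b)
    (hW : WeakZAt 2 1 (Matrix.diagonal fun j => ((![a, b, b, 1] : Fin 4 → ℝ) j : ℂ))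
      ![(α : ℂ), 0, 0, r] B) :
    a * (B 0 0).re + b * ((B 1 1).re + (B 2 2).re) + (B 0 0).re * (α ^ 2 / r ^ 2) ≤
      (r ^ 2 * a + α ^ 2) / (r ^ 2 + α ^ 2) + b := by
  have hN : 0 < r ^ 2 + α ^ 2 := by positivity
  set N := Real.sqrt (r ^ 2 + α ^ 2) with hNdef
  have hNN : (N : ℂ) ^ 2 = r ^ 2 + α ^ 2 := by
    rw [hNdef]; exact_mod_cast Real.sq_sqrt hN.le
  have hNC : (N : ℂ) ≠ 0 := by exact_mod_cast (Real.sqrt_pos.2 hN).ne'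
  have h33 := diag_eq_of_tangential hW.1 (i := 0) (l := 3) (α := α) hr
    (fun k => by simp [Fin.sum_univ_four])
  have hNC2 : (r : ℂ) ^ 2 + (α : ℂ) ^ 2 ≠ 0 := by exact_mod_cast hN.ne'
  have h1 := hW.2.2.1 (![(r ^ 2 * a + α ^ 2) / (r ^ 2 + α ^ 2), b, b] : Fin 3 → ℝ) ⟨by
      intro i j hij
      change Fin 3 at i j
      fin_cases i <;> fin_cases j <;> simp at hij ⊢ <;> exact hab,
    (![![r / N, 0, 0, -α / N], ![0, 1, 0, 0], ![0, 0, 1, 0]] : Fin 3 → Fin 4 → ℂ), by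
      intro i
      change Fin 3 at i
      fin_cases i <;> simp [Fin.sum_univ_four]
      ring, by
      intro i j
      change Fin 3 at i j
      rw [← Matrix.diagonal_one, sesqForm_diagonal]
      fin_cases i <;> fin_cases j <;> simp [Fin.sum_univ_four]
      field_simp
      linear_combination -hNN, by
      intro i j
      change Fin 3 at i j
      rw [sesqForm_diagonal]
      fin_cases i <;> fin_cases j <;> simp [Fin.sum_univ_four]
      field_simp
      rw [hNN]
      field_simp⟩
  have h2 : (∑ i : Fin (4 - 1) with i.val < 2,
      (![(r ^ 2 * a + α ^ 2) / (r ^ 2 + α ^ 2), b, b] : Fin 3 → ℝ) i) =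
      (r ^ 2 * a + α ^ 2) / (r ^ 2 + α ^ 2) + b := by
    show (∑ i : Fin 3 with i.val < 2, _) = _
    rw [Finset.sum_filter, Fin.sum_univ_three]
    simp
  rw [h2, pairing11_diagonal, Fin.sum_univ_four, h33] at h1
  simp only [Matrix.cons_val] at h1
  linarith

/-- The inequality of weak `Z(2)` at a point `(0, ε, 0, *)`. The eigenvectors of the Levi form are the
third coordinate vector, `(0, r, 0, -β)` up to normalization, and the first coordinate vector. -/
theorem weakZAt_axis_one {B : Matrix (Fin 4) (Fin 4) ℂ} {β r a b c : ℝ} (hr : r ≠ 0)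
    (hcb : c ≤ (r ^ 2 * b + β ^ 2) / (r ^ 2 + β ^ 2))
    (hba : (r ^ 2 * b + β ^ 2) / (r ^ 2 + β ^ 2) ≤ a)
    (hW : WeakZAt 2 1 (Matrix.diagonal fun j => ((![a, b, c, 1] : Fin 4 → ℝ) j : ℂ))
      ![0, (β : ℂ), 0, r] B) :
    a * (B 0 0).re + b * (B 1 1).re + c * (B 2 2).re + (B 1 1).re * (β ^ 2 / r ^ 2) ≤
      c + (r ^ 2 * b + β ^ 2) / (r ^ 2 + β ^ 2) := by
  have hN : 0 < r ^ 2 + β ^ 2 := by positivity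
  set N := Real.sqrt (r ^ 2 + β ^ 2) with hNdef
  have hNN : (N : ℂ) ^ 2 = r ^ 2 + β ^ 2 := by
    rw [hNdef]; exact_mod_cast Real.sq_sqrt hN.le
  have hNC : (N : ℂ) ≠ 0 := by exact_mod_cast (Real.sqrt_pos.2 hN).ne'
  have h33 := diag_eq_of_tangential hW.1 (i := 1) (l := 3) (α := β) hr
    (fun k => by simp [Fin.sum_univ_four])
  have hNC2 : (r : ℂ) ^ 2 + (β : ℂ) ^ 2 ≠ 0 := by exact_mod_cast hN.ne'
  have h1 := hW.2.2.1 (![c, (r ^ 2 * b + β ^ 2) / (r ^ 2 + β ^ 2), a] : Fin 3 → ℝ) ⟨by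
      intro i j hij
      change Fin 3 at i j
      have hca := hcb.trans hba
      fin_cases i <;> fin_cases j <;> simp at hij ⊢ <;> assumption,
    (![![0, 0, 1, 0], ![0, r / N, 0, -β / N], ![1, 0, 0, 0]] : Fin 3 → Fin 4 → ℂ), by
      intro i
      change Fin 3 at i
      fin_cases i <;> simp [Fin.sum_univ_four]
      ring, by
      intro i j
      change Fin 3 at i j
      rw [← Matrix.diagonal_one, sesqForm_diagonal]
      fin_cases i <;> fin_cases j <;> simp [Fin.sum_univ_four]
      field_simp
      linear_combination -hNN, by
      intro i j
      change Fin 3 at i j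
      rw [sesqForm_diagonal]
      fin_cases i <;> fin_cases j <;> simp [Fin.sum_univ_four]
      field_simp
      rw [hNN]
      field_simp⟩
  have h2 : (∑ i : Fin (4 - 1) with i.val < 2,
      (![c, (r ^ 2 * b + β ^ 2) / (r ^ 2 + β ^ 2), a] : Fin 3 → ℝ) i) =
      c + (r ^ 2 * b + β ^ 2) / (r ^ 2 + β ^ 2) := by
    show (∑ i : Fin 3 with i.val < 2, _) = _
    rw [Finset.sum_filter, Fin.sum_univ_three]
    simp
  rw [h2, pairing11_diagonal, Fin.sum_univ_four, h33] at h1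
  simp only [Matrix.cons_val] at h1
  linarith

/-- `f ≤ g` to the right of `0` passes to the limit at `0`. -/
theorem le_at_zero_of_eventually_le {f g : ℝ → ℝ} (hf : ContinuousAt f 0) (hg : ContinuousAt g 0)
    (h : ∀ᶠ e in 𝓝[>] (0 : ℝ), f e ≤ g e) : f 0 ≤ g 0 :=
  le_of_tendsto_of_tendsto (hf.mono_left nhdsWithin_le_nhds) (hg.mono_left nhdsWithin_le_nhds) h

/-- The last coordinate of a boundary point `(e, 0, 0, r)`. -/
noncomputable def axisHeightZero (e : ℝ) : ℝ := Real.sqrt (1 + 9 * e ^ 4 - 96 * e ^ 6)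

/-- The last coordinate of a boundary point `(0, e, 0, r)`. -/
noncomputable def axisHeightOne (e : ℝ) : ℝ := Real.sqrt (1 - e ^ 4)

/-- Approaching `(0, 0, 0, 1)` along `(e, 0, 0, *)`, weak `Z(2)` forces `b^{1̄1} ≥ 2/3`. -/
theorem two_thirds_le_of_weakZAt {B : (Fin 4 → ℂ) → Matrix (Fin 4) (Fin 4) ℂ}
    (hB : ∀ i j, Continuous fun z => B z i j)
    (hW : ∀ z ∈ frontier quarticDomain,
      WeakZAt 2 1 (complexHessian quarticRho z) (delForm quarticRho z) (B z)) :
    2 / 3 ≤ (B ![0, 0, 0, 1] 0 0).re := by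
  have hr : Continuous axisHeightZero := by unfold axisHeightZero; fun_prop
  have hr0 : axisHeightZero 0 = 1 := by simp [axisHeightZero]
  have hq : Continuous fun e : ℝ => (![(e : ℂ), 0, 0, (axisHeightZero e : ℂ)] : Fin 4 → ℂ) := by
    refine continuous_pi fun i => ?_
    fin_cases i <;> simp <;> fun_prop
  have hb : ∀ i, Continuous fun e : ℝ =>
      (B ![(e : ℂ), 0, 0, (axisHeightZero e : ℂ)] i i).re := fun i =>
    Complex.continuous_re.comp ((hB i i).comp hq)
  have hpos : ∀ᶠ e in 𝓝 (0 : ℝ), 0 < axisHeightZero e :=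
    hr.continuousAt.eventually_const_lt (by rw [hr0]; norm_num)
  -- The negative eigenvalue of the Levi form, divided by `e ^ 2`.
  set m : ℝ → ℝ := fun e => (axisHeightZero e ^ 2 * (-36 + 864 * e ^ 2) +
    (-18 * e ^ 2 + 288 * e ^ 4) ^ 2) / (axisHeightZero e ^ 2 +
      e ^ 2 * (-18 * e ^ 2 + 288 * e ^ 4) ^ 2) with hm
  have hmc : ContinuousAt m 0 := by
    refine ContinuousAt.div (by fun_prop) (by fun_prop) ?_
    rw [hr0]; norm_num
  have hm0 : m 0 = -36 := by simp [hm, hr0]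
  have hmlt : ∀ᶠ e in 𝓝 (0 : ℝ), m e < 12 := hmc.eventually_lt_const (by rw [hm0]; norm_num)
  have hlim := le_at_zero_of_eventually_le
    (f := fun e => (-36 + 864 * e ^ 2) * (B ![(e : ℂ), 0, 0, (axisHeightZero e : ℂ)] 0 0).re +
      12 * ((B ![(e : ℂ), 0, 0, (axisHeightZero e : ℂ)] 1 1).re +
        (B ![(e : ℂ), 0, 0, (axisHeightZero e : ℂ)] 2 2).re) +
      (B ![(e : ℂ), 0, 0, (axisHeightZero e : ℂ)] 0 0).re *
        ((-18 * e ^ 2 + 288 * e ^ 4) ^ 2 / axisHeightZero e ^ 2))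
    (g := fun e => m e + 12) ?_ (hmc.add continuousAt_const) ?_
  · have hp : WeakZAt 2 1 _ _ _ := hW ![0, 0, 0, 1] (mem_frontier_quarticDomain (by
      simp [quarticRho]))
    have h1 := nonneg_diag_of_weakZAt hp (j := 1) (by simp [delForm_quarticRho])
    have h2 := nonneg_diag_of_weakZAt hp (j := 2) (by simp [delForm_quarticRho])
    simp only [hm0, hr0] at hlim
    norm_num at hlim
    linarith
  · have h0 := (hb 0).continuousAt (x := 0)
    have h1 := (hb 1).continuousAt (x := 0)
    have h2 := (hb 2).continuousAt (x := 0)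
    refine (((by fun_prop : ContinuousAt (fun e : ℝ => -36 + 864 * e ^ 2) 0).mul h0).add
      (continuousAt_const.mul (h1.add h2))).add (h0.mul (ContinuousAt.div (by fun_prop)
        (by fun_prop) ?_))
    rw [hr0]; norm_num
  · filter_upwards [hpos.filter_mono nhdsWithin_le_nhds, hmlt.filter_mono nhdsWithin_le_nhds,
      self_mem_nhdsWithin] with e her hme he
    have he0 : 0 < e := he
    have hrsq : axisHeightZero e ^ 2 = 1 + 9 * e ^ 4 - 96 * e ^ 6 :=
      Real.sq_sqrt (Real.sqrt_pos.1 her).le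
    have hWe := hW ![(e : ℂ), 0, 0, (axisHeightZero e : ℂ)] (mem_frontier_quarticDomain (by
      simp [quarticRho, hrsq]; ring))
    have hH : complexHessian quarticRho ![(e : ℂ), 0, 0, (axisHeightZero e : ℂ)] =
        Matrix.diagonal fun j => ((![e ^ 2 * (-36 + 864 * e ^ 2), e ^ 2 * 12, e ^ 2 * 12, 1] :
          Fin 4 → ℝ) j : ℂ) := by
      rw [complexHessian_quarticRho]
      ext i j
      fin_cases i <;> fin_cases j <;> simp [← Complex.ofReal_pow] <;> push_cast <;> ring
    have hd : delForm quarticRho ![(e : ℂ), 0, 0, (axisHeightZero e : ℂ)] =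
        ![((e * (-18 * e ^ 2 + 288 * e ^ 4) : ℝ) : ℂ), 0, 0, axisHeightZero e] := by
      rw [delForm_quarticRho]
      funext i
      fin_cases i <;> simp [quarticCoeff]
      ring
    rw [hH, hd] at hWe
    have hms : (axisHeightZero e ^ 2 * (e ^ 2 * (-36 + 864 * e ^ 2)) +
        (e * (-18 * e ^ 2 + 288 * e ^ 4)) ^ 2) / (axisHeightZero e ^ 2 +
          (e * (-18 * e ^ 2 + 288 * e ^ 4)) ^ 2) = e ^ 2 * m e := by
      simp only [hm, mul_pow]
      rw [← mul_div_assoc]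
      congr 1
      ring
    have he2 : 0 < e ^ 2 := by positivity
    have h1 := weakZAt_axis_zero her.ne' (by rw [hms]; exact mul_le_mul_of_nonneg_left hme.le he2.le)
      hWe
    rw [hms] at h1
    refine le_of_mul_le_mul_left ?_ he2
    refine le_trans (le_of_eq ?_) (h1.trans (le_of_eq ?_))
    · ring
    · ring

/-- Approaching `(0, 0, 0, 1)` along `(0, e, 0, *)`, weak `Z(2)` forces `b^{1̄1} ≤ 1/2`. -/
theorem le_half_of_weakZAt {B : (Fin 4 → ℂ) → Matrix (Fin 4) (Fin 4) ℂ}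
    (hB : ∀ i j, Continuous fun z => B z i j)
    (hW : ∀ z ∈ frontier quarticDomain,
      WeakZAt 2 1 (complexHessian quarticRho z) (delForm quarticRho z) (B z)) :
    (B ![0, 0, 0, 1] 0 0).re ≤ 1 / 2 := by
  have hr : Continuous axisHeightOne := by unfold axisHeightOne; fun_prop
  have hr0 : axisHeightOne 0 = 1 := by simp [axisHeightOne]
  have hq : Continuous fun e : ℝ => (![0, (e : ℂ), 0, (axisHeightOne e : ℂ)] : Fin 4 → ℂ) := by
    refine continuous_pi fun i => ?_
    fin_cases i <;> simp <;> fun_prop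
  have hb : ∀ i, Continuous fun e : ℝ =>
      (B ![0, (e : ℂ), 0, (axisHeightOne e : ℂ)] i i).re := fun i =>
    Complex.continuous_re.comp ((hB i i).comp hq)
  have hpos : ∀ᶠ e in 𝓝 (0 : ℝ), 0 < axisHeightOne e :=
    hr.continuousAt.eventually_const_lt (by rw [hr0]; norm_num)
  -- The middle eigenvalue of the Levi form, divided by `e ^ 2`.
  set m : ℝ → ℝ := fun e => (axisHeightOne e ^ 2 * 4 + (2 * e ^ 2) ^ 2) / (axisHeightOne e ^ 2 +
      e ^ 2 * (2 * e ^ 2) ^ 2) with hm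
  have hmc : ContinuousAt m 0 := by
    refine ContinuousAt.div (by fun_prop) (by fun_prop) ?_
    rw [hr0]; norm_num
  have hm0 : m 0 = 4 := by simp [hm, hr0]
  have hmlt : ∀ᶠ e in 𝓝 (0 : ℝ), m e < 12 := hmc.eventually_lt_const (by rw [hm0]; norm_num)
  have hmgt : ∀ᶠ e in 𝓝 (0 : ℝ), 2 < m e := hmc.eventually_const_lt (by rw [hm0]; norm_num)
  have hlim := le_at_zero_of_eventually_le
    (f := fun e => 12 * (B ![0, (e : ℂ), 0, (axisHeightOne e : ℂ)] 0 0).re +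
      4 * (B ![0, (e : ℂ), 0, (axisHeightOne e : ℂ)] 1 1).re +
      2 * (B ![0, (e : ℂ), 0, (axisHeightOne e : ℂ)] 2 2).re +
      (B ![0, (e : ℂ), 0, (axisHeightOne e : ℂ)] 1 1).re *
        ((2 * e ^ 2) ^ 2 / axisHeightOne e ^ 2))
    (g := fun e => 2 + m e) ?_ (continuousAt_const.add hmc) ?_
  · have hp : WeakZAt 2 1 _ _ _ := hW ![0, 0, 0, 1] (mem_frontier_quarticDomain (by
      simp [quarticRho]))
    have h1 := nonneg_diag_of_weakZAt hp (j := 1) (by simp [delForm_quarticRho])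
    have h2 := nonneg_diag_of_weakZAt hp (j := 2) (by simp [delForm_quarticRho])
    simp only [hm0, hr0] at hlim
    norm_num at hlim
    linarith
  · have h0 := (hb 0).continuousAt (x := 0)
    have h1 := (hb 1).continuousAt (x := 0)
    have h2 := (hb 2).continuousAt (x := 0)
    refine (((continuousAt_const.mul h0).add (continuousAt_const.mul h1)).add
      (continuousAt_const.mul h2)).add (h1.mul (ContinuousAt.div (by fun_prop) (by fun_prop) ?_))
    rw [hr0]; norm_num
  · filter_upwards [hpos.filter_mono nhdsWithin_le_nhds, hmlt.filter_mono nhdsWithin_le_nhds,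
      hmgt.filter_mono nhdsWithin_le_nhds, self_mem_nhdsWithin] with e her hme hme' he
    have he0 : 0 < e := he
    have hrsq : axisHeightOne e ^ 2 = 1 - e ^ 4 := Real.sq_sqrt (Real.sqrt_pos.1 her).le
    have hWe := hW ![0, (e : ℂ), 0, (axisHeightOne e : ℂ)] (mem_frontier_quarticDomain (by
      simp [quarticRho, hrsq]; ring))
    have hH : complexHessian quarticRho ![0, (e : ℂ), 0, (axisHeightOne e : ℂ)] =
        Matrix.diagonal fun j => ((![e ^ 2 * 12, e ^ 2 * 4, e ^ 2 * 2, 1] :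
          Fin 4 → ℝ) j : ℂ) := by
      rw [complexHessian_quarticRho]
      ext i j
      fin_cases i <;> fin_cases j <;> simp [← Complex.ofReal_pow] <;> ring
    have hd : delForm quarticRho ![0, (e : ℂ), 0, (axisHeightOne e : ℂ)] =
        ![0, ((e * (2 * e ^ 2) : ℝ) : ℂ), 0, axisHeightOne e] := by
      rw [delForm_quarticRho]
      funext i
      fin_cases i <;> simp [quarticCoeff]
      ring
    rw [hH, hd] at hWe
    have hms : (axisHeightOne e ^ 2 * (e ^ 2 * 4) + (e * (2 * e ^ 2)) ^ 2) /
        (axisHeightOne e ^ 2 + (e * (2 * e ^ 2)) ^ 2) = e ^ 2 * m e := by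
      simp only [hm, mul_pow]
      rw [← mul_div_assoc]
      congr 1
      ring
    have he2 : 0 < e ^ 2 := by positivity
    have h1 := weakZAt_axis_one her.ne'
      (by rw [hms]; exact mul_le_mul_of_nonneg_left hme'.le he2.le)
      (by rw [hms]; exact mul_le_mul_of_nonneg_left hme.le he2.le) hWe
    rw [hms] at h1
    refine le_of_mul_le_mul_left ?_ he2
    refine le_trans (le_of_eq ?_) (h1.trans (le_of_eq ?_))
    · ring
    · ring

theorem not_satisfiesWeakZ_euclidean (k : ℕ∞) :
    ¬ SatisfiesWeakZ k 2 (fun z : Fin 4 → ℂ => ∑ j, ‖z j‖ ^ 2) quarticDomain := by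
  intro hW
  obtain ⟨B, hB, hWz⟩ := hW.weakZAt (isDefiningFunction_quarticRho 2)
  simp only [complexHessian_euclidean] at hWz
  have h1 := two_thirds_le_of_weakZAt (fun i j => (hB i j).continuous) hWz
  have h2 := le_half_of_weakZAt (fun i j => (hB i j).continuous) hWz
  linarith

theorem proposition6p3 :
    ∃ Ω : Set (Fin 4 → ℂ), IsSmoothBoundedDomain Ω ∧
      (∀ k : ℕ∞, 1 ≤ k → ¬ SatisfiesWeakZ k 2 (fun z => ∑ j, ‖z j‖ ^ 2) Ω) ∧
      (∀ t : ℝ, 6 ≤ t → IsStrictlyPshExhaustion (potential t) ∧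
        ∀ k : ℕ∞, 1 ≤ k → SatisfiesWeakZ k 2 (potential t) Ω) :=
  ⟨quarticDomain, isSmoothBoundedDomain_quarticDomain,
    fun k _ => not_satisfiesWeakZ_euclidean k,
    fun _ ht => ⟨isStrictlyPshExhaustion_potential ht, fun k _ => satisfiesWeakZ_potential ht k⟩⟩
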